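/- Let $\mathbb{K}$ be an algebraically closed field and let $\mathcal{C}$ be a modular tensor category over $\mathbb{K}$, i.e. a spherical fusion category with a balanced braiding whose $S$-matrix is invertible. Let $\mathcal{I}$ be a complete set of simple objects of $\mathcal{C}$, let $d(X)$ be the categorical dimension of $X$ and let $d(\mathcal{C})=\sum_{S\in\mathcal{I}}d(S)^2$. Let $F=\mathbb{K}\otimes_{\mathbb{Z}}\mathrm{Gr}(\mathcal{C})$ be the fusion algebra, and let $\mathcal{TC}$ be the tube category, with $\mathrm{Hom}_{\mathcal{TC}}(X,Y)=\bigoplus_{S\in\mathcal{I}}\mathrm{Hom}_{\mathcal{C}}(S\otimes X,Y\otimes S)$ and composition given by stacking cylinders. For objects $X,Y$ let $\mathrm{enc}_Y(X)\in\mathrm{End}_{\mathcal{C}}(Y)$ be the endomorphism given by a strand $Y$ encircled by a closed loop $X$, i.e. the partial trace over $X$ of the double braiding of $Y$ and $X$. For $I\in\mathcal{I}$ put $$\mathbf{1}_I=\frac{d(I)}{d(\mathcal{C})}\sum_{S\in\mathcal{I}}d(S)\,\mathrm{enc}_S(I)\in\bigoplus_{S}\mathrm{End}_{\mathcal{C}}(S)=\mathrm{End}_{\mathcal{TC}}(\mathbf{1}).$$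 Then: 1. The canonical map $\mathrm{End}_{\mathcal{TC}}(\mathbf{1})=\bigoplus_S\mathrm{End}_{\mathcal{C}}(S)\to F$, $\mathrm{id}_S\mapsto[S]$, is an isomorphism of $\mathbb{K}$-algebras. 2. For each $I\in\mathcal{I}$ there is an algebra homomorphism $\lambda_I\colon F\to\mathbb{K}$ with $\lambda_I([S])\,\mathrm{id}_{I^\vee}=\mathrm{enc}_{I^\vee}(S)$ for all $S\in\mathcal{I}$, and $I\mapsto\lambda_I$ is a bijection from $\mathcal{I}$ onto $\mathrm{Spec}(F)=\mathrm{Hom}_{\mathrm{alg}}(F,\mathbb{K})$. 3. For each $I\in\mathcal{I}$ one has $d(I)\neq0$, $d(\mathcal{C})\neq0$ and $$\|\lambda_I\|^2:=\sum_{S\in\mathcal{I}}\lambda_I([S])\,\lambda_I([S^\vee])=\frac{d(\mathcal{C})}{d(I)^2}.$$ The element $e_{\lambda_I}=\|\lambda_I\|^{-2}\sum_{S\in\mathcal{I}}\lambda_I([S^\vee])\,[S]$ is the unique idempotent $e\in F$ with $\lambda_I(e)=1$ and $\mu(e)=0$ for every $\mu\in\mathrm{Spec}(F)\setminus\{\lambda_I\}$,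 it is primitive, and under the isomorphism of (1) $$e_{\lambda_I}=\mathbf{1}_I.$$ -/

import Mathlib

open CategoryTheory MonoidalCategory Limits
open scoped TensorProduct

noncomputable section

namespace TubeCat

universe w v u

attribute [local instance] Abelian.hasFiniteBiproducts

/-- Together with rigidity and bilinearity of the tensor product (asked for separately), this says
that the abelian `K`-linear monoidal category `C` is a fusion category. -/
class IsFusionCategory (K : Type w) (C : Type u) [Field K] [Category.{v} C] [Abelian C]
    [Linear K C] [MonoidalCategory C] : Prop where
  finiteDimensional_hom : ∀ X Y : C, FiniteDimensional K (X ⟶ Y)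
  simple_unit : Simple (𝟙_ C)
  semisimple : ∀ X : C, ∃ (n : ℕ) (s : Fin n → C), (∀ k, Simple (s k)) ∧ Nonempty (X ≅ ⨁ s)
  finite_simples : ∃ (n : ℕ) (s : Fin n → C), ∀ X : C, Simple X → ∃ k, Nonempty (X ≅ s k)

/-- `S` is a complete set of simple objects: each isomorphism class of simple objects is
represented exactly once. -/
class IsCompleteSimples {C : Type u} [Category.{v} C] [Abelian C] {ι : Type*} (S : ι → C) :
    Prop where
  simple : ∀ i, Simple (S i)
  eq_of_iso : ∀ i j, Nonempty (S i ≅ S j) → i = j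
  exists_iso : ∀ X : C, Simple X → ∃ i, Nonempty (X ≅ S i)

attribute [instance] IsFusionCategory.finiteDimensional_hom IsCompleteSimples.simple

/-- The dual `X^∨` of an object of a rigid category, with evaluation `X^∨ ⊗ X ⟶ 𝟙` and coevaluation
`𝟙 ⟶ X ⊗ X^∨`. -/
abbrev dual {C : Type u} [Category.{v} C] [MonoidalCategory C] [RightRigidCategory C] (X : C) : C :=
  HasRightDual.rightDual X

/-- The canonical isomorphism `(X ⊗ Y)^∨∨ ≅ X^∨∨ ⊗ Y^∨∨`, as a morphism. -/
def doubleDualTensor {C : Type u} [Category.{v} C] [MonoidalCategory C] [RightRigidCategory C]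
    (X Y : C) : dual (dual (X ⊗ Y)) ⟶ dual (dual X) ⊗ dual (dual Y) :=
  rightAdjointMate (rightDualTensorIso X Y).inv ≫ (rightDualTensorIso (dual Y) (dual X)).hom

/-- A pivotal structure: a monoidal natural isomorphism from the identity functor to the double
dual functor. (Compatibility with the unit follows from compatibility with tensor products,
because the components are invertible.) -/
class PivotalCategory (C : Type u) [Category.{v} C] [MonoidalCategory C] [RightRigidCategory C]
    where
  pivot : ∀ X : C, X ≅ dual (dual X)
  naturality : ∀ {X Y : C} (f : X ⟶ Y),
    f ≫ (pivot Y).hom = (pivot X).hom ≫ rightAdjointMate (rightAdjointMate f)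
  tensor : ∀ X Y : C,
    (pivot (X ⊗ Y)).hom ≫ doubleDualTensor X Y = (pivot X).hom ⊗ₘ (pivot Y).hom

section Pivotal

variable {C : Type u} [Category.{v} C] [MonoidalCategory C] [RightRigidCategory C]
  [PivotalCategory C]

/-- The right evaluation `X ⊗ dual X ⟶ 𝟙_ C` given by the pivotal structure. -/
def pivotalEval (X : C) : X ⊗ dual X ⟶ 𝟙_ C :=
  (PivotalCategory.pivot X).hom ▷ dual X ≫ ε_ (dual X) (dual (dual X))

/-- The right categorical trace. -/
def rightTrace {X : C} (f : X ⟶ X) : 𝟙_ C ⟶ 𝟙_ C :=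
  η_ X (dual X) ≫ f ▷ dual X ≫ pivotalEval X

/-- The left categorical trace. -/
def leftTrace {X : C} (f : X ⟶ X) : 𝟙_ C ⟶ 𝟙_ C :=
  η_ (dual X) (dual (dual X)) ≫ dual X ◁ ((PivotalCategory.pivot X).inv ≫ f) ≫ ε_ X (dual X)

variable (C) in
/-- A pivotal category is spherical if left and right traces coincide. -/
class IsSpherical : Prop where
  leftTrace_eq_rightTrace : ∀ {X : C} (f : X ⟶ X), leftTrace f = rightTrace f

variable [BraidedCategory C]

/-- The double braiding `X ⊗ Y ⟶ Y ⊗ X ⟶ X ⊗ Y`. -/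
def doubleBraiding (X Y : C) : X ⊗ Y ⟶ X ⊗ Y := (β_ X Y).hom ≫ (β_ Y X).hom

/-- The endomorphism of `Y` given by a strand `Y` encircled by a closed loop `X`, i.e. the partial
trace over `X` of the double braiding of `Y` and `X`. -/
def encircle (Y X : C) : Y ⟶ Y :=
  (ρ_ Y).inv ≫ Y ◁ η_ X (dual X) ≫ (α_ Y X (dual X)).inv ≫ doubleBraiding Y X ▷ dual X ≫
    (α_ Y X (dual X)).hom ≫ Y ◁ pivotalEval X ≫ (ρ_ Y).hom

end Pivotal

/-- A braiding is balanced if it admits a twist: a natural automorphism `θ` of the identity functor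
with `θ_{X ⊗ Y} = c_{Y,X} ∘ c_{X,Y} ∘ (θ_X ⊗ θ_Y)`. -/
def IsBalanced (C : Type u) [Category.{v} C] [MonoidalCategory C] [BraidedCategory C] : Prop :=
  ∃ θ : 𝟭 C ≅ 𝟭 C, ∀ X Y : C,
    θ.hom.app (X ⊗ Y) = (θ.hom.app X ⊗ₘ θ.hom.app Y) ≫ (β_ X Y).hom ≫ (β_ Y X).hom

theorem exists_retraction (K : Type w) [Field K] {C : Type u} [Category.{v} C] [Abelian C]
    [Linear K C] [MonoidalCategory C] [IsFusionCategory K C] {T X : C} [Simple T] (f : T ⟶ X) (hf : f ≠ 0) :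
    ∃ g : X ⟶ T, f ≫ g = 𝟙 T := by
  obtain ⟨n, s, hs, ⟨e⟩⟩ := IsFusionCategory.semisimple (K := K) X
  obtain ⟨k, hk⟩ : ∃ k, f ≫ e.hom ≫ biproduct.π s k ≠ 0 := by
    by_contra! h
    apply hf
    rw [← cancel_mono e.hom, zero_comp]
    ext k
    simpa using h k
  haveI := hs k
  haveI := isIso_of_hom_simple hk
  exact ⟨(e.hom ≫ biproduct.π s k) ≫ inv (f ≫ e.hom ≫ biproduct.π s k), by
    rw [← Category.assoc, IsIso.hom_inv_id]⟩

section Linear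

variable (K : Type w) [Field K] [IsAlgClosed K]
variable {C : Type u} [Category.{v} C] [Abelian C] [Linear K C] [MonoidalCategory C]
  [IsFusionCategory K C]

/-- The identification `End(X) = K` for a simple object `X`. -/
def scalar {X : C} [Simple X] (f : X ⟶ X) : K :=
  (endomorphism_simple_eq_smul_id K f).choose

theorem scalar_smul_id {X : C} [Simple X] (f : X ⟶ X) : scalar K f • 𝟙 X = f :=
  (endomorphism_simple_eq_smul_id K f).choose_spec

theorem scalar_eq {X : C} [Simple X] {f : X ⟶ X} {c : K} (h : c • 𝟙 X = f) : scalar K f = c :=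
  smul_left_injective K (id_nonzero X) ((scalar_smul_id K f).trans h.symm)

theorem scalar_add {X : C} [Simple X] (f g : X ⟶ X) :
    scalar K (f + g) = scalar K f + scalar K g :=
  scalar_eq K (by rw [add_smul, scalar_smul_id, scalar_smul_id])

theorem scalar_smul {X : C} [Simple X] (c : K) (f : X ⟶ X) :
    scalar K (c • f) = c * scalar K f :=
  scalar_eq K (by rw [mul_smul, scalar_smul_id])

/-- The identification `End(𝟙) = K`. -/
def unitScalar (f : 𝟙_ C ⟶ 𝟙_ C) : K :=
  haveI := IsFusionCategory.simple_unit (K := K) (C := C)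
  scalar K f

/-- The composition pairing `Hom(X, T) × Hom(T, X) → End(T) = K` for a simple object `T`. -/
def compPairing (T X : C) [Simple T] : (X ⟶ T) →ₗ[K] Module.Dual K (T ⟶ X) :=
  LinearMap.mk₂ K (fun g f => scalar K (f ≫ g))
    (fun _ _ _ => by rw [Preadditive.comp_add, scalar_add])
    (fun _ _ _ => by rw [Linear.comp_smul, scalar_smul, smul_eq_mul])
    (fun _ _ _ => by rw [Preadditive.add_comp, scalar_add])
    (fun _ _ _ => by rw [Linear.smul_comp, scalar_smul, smul_eq_mul])

theorem compPairing_surjective (T X : C) [Simple T] :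
    Function.Surjective (compPairing K T X) := by
  rw [← LinearMap.flip_injective_iff₂, injective_iff_map_eq_zero]
  intro f hf
  by_contra hne
  obtain ⟨g, hg⟩ := exists_retraction K f hne
  have h1 : scalar K (f ≫ g) = 0 := LinearMap.congr_fun hf g
  have h2 : scalar K (f ≫ g) = 1 := scalar_eq K (by rw [one_smul, hg])
  exact one_ne_zero (h2.symm.trans h1)

/-- A basis `{b}` of `Hom(T, X)`, for `T` simple. -/
def homBasis (T X : C) : Module.Basis (Fin (Module.finrank K (T ⟶ X))) K (T ⟶ X) :=
  Module.finBasis K (T ⟶ X)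

/-- The basis `{b*}` of `Hom(X, T)` dual to `homBasis K T X` with respect to the composition
pairing. -/
def homDualBasis (T X : C) [Simple T] (k : Fin (Module.finrank K (T ⟶ X))) : X ⟶ T :=
  (compPairing_surjective K T X ((homBasis K T X).coord k)).choose

theorem homBasis_comp_homDualBasis (T X : C) [Simple T]
    (k l : Fin (Module.finrank K (T ⟶ X))) :
    homBasis K T X k ≫ homDualBasis K T X l = if k = l then 𝟙 T else 0 := by
  have h := LinearMap.congr_fun
    (compPairing_surjective K T X ((homBasis K T X).coord l)).choose_spec (homBasis K T X k)
  have h' : scalar K (homBasis K T X k ≫ homDualBasis K T X l) = if k = l then 1 else 0 := by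
    refine Eq.trans h ?_
    rw [Module.Basis.coord_apply, Module.Basis.repr_self, Finsupp.single_apply]
  rw [← scalar_smul_id K (homBasis K T X k ≫ homDualBasis K T X l), h']
  split_ifs <;> simp

/-! ### The tube category -/

variable {ι : Type*} [Fintype ι] (S : ι → C)

/-- Morphisms `X ⟶ Y` in the tube category: `⨁_S Hom(S ⊗ X, Y ⊗ S)`, the sum being over the
(finitely many) simple objects. -/
abbrev TubeHom (X Y : C) : Type _ := ∀ i : ι, (S i ⊗ X ⟶ Y ⊗ S i)

variable [IsCompleteSimples S]

/-- The morphism `α_G` of the tube category given by `α : G ⊗ X ⟶ Y ⊗ G` for an arbitrary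
object `G`, namely `⨁_T ∑_b (id_Y ⊗ b*) ∘ α ∘ (b ⊗ id_X)`. -/
def tubeOf {X Y : C} (G : C) (a : G ⊗ X ⟶ Y ⊗ G) : TubeHom S X Y := fun t =>
  ∑ k, homBasis K (S t) G k ▷ X ≫ a ≫ Y ◁ homDualBasis K (S t) G k

/-- Composition in the tube category: `b` after `a`, obtained by stacking cylinders. -/
def tubeComp {X Y Z : C} (b : TubeHom S Y Z) (a : TubeHom S X Y) : TubeHom S X Z :=
  ∑ h, ∑ g, tubeOf K S (S h ⊗ S g)
    ((α_ (S h) (S g) X).hom ≫ S h ◁ a g ≫ (α_ (S h) Y (S g)).inv ≫ b h ▷ S g ≫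
      (α_ Z (S h) (S g)).hom)

/-- The identity of `X` in the tube category. -/
def tubeId (X : C) : TubeHom S X X := tubeOf K S (𝟙_ C) ((λ_ X).hom ≫ (ρ_ X).inv)

end Linear

section Fusion

variable (K : Type w) [Field K]
variable (C : Type u) [Category.{v} C] [Abelian C] [MonoidalCategory C] [BraidedCategory C]

/-- The ideal of relations `[X ⊕ Y] = [X] + [Y]`. (In a semisimple category every short exact
sequence splits, so that these are all the relations of the Grothendieck ring.) -/
def grothendieckRelations : Ideal (MonoidAlgebra ℤ (Skeleton C)) :=
  Ideal.span {x | ∃ X Y : C, x = MonoidAlgebra.of ℤ _ (toSkeleton (X ⊞ Y)) -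
    (MonoidAlgebra.of ℤ _ (toSkeleton X) + MonoidAlgebra.of ℤ _ (toSkeleton Y))}

/-- The Grothendieck ring of a (braided, semisimple) monoidal category: the ring generated by the
monoid of isomorphism classes of objects under `⊗`, modulo `[X ⊕ Y] = [X] + [Y]`. -/
abbrev GrothendieckRing : Type _ := MonoidAlgebra ℤ (Skeleton C) ⧸ grothendieckRelations C

/-- The fusion algebra `F = K ⊗ Gr(C)`. -/
abbrev FusionAlgebra : Type _ := K ⊗[ℤ] GrothendieckRing C

variable {C} in
/-- The class of an object in the fusion algebra. -/
def cls (X : C) : FusionAlgebra K C :=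
  1 ⊗ₜ[ℤ] Ideal.Quotient.mk (grothendieckRelations C) (MonoidAlgebra.of ℤ _ (toSkeleton X))

end Fusion

section Modular

variable (K : Type w) [Field K] [IsAlgClosed K]
variable {C : Type u} [Category.{v} C] [Abelian C] [Linear K C] [MonoidalCategory C]
  [IsFusionCategory K C] [RigidCategory C] [PivotalCategory C] [BraidedCategory C]

/-- The categorical dimension `d(X)`. -/
def dim (X : C) : K := unitScalar K (rightTrace (𝟙 X))

variable {ι : Type*} [Fintype ι] (S : ι → C)

/-- The global dimension `d(C)`, the sum of `d(S)²` over the simple objects. -/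
def globalDim : K := ∑ i, dim K (S i) ^ 2

/-- The `S`-matrix: traces of the double braidings of pairs of simple objects. -/
def sMatrix : Matrix ι ι K := fun i j => unitScalar K (rightTrace (doubleBraiding (S i) (S j)))

/-- The spherical fusion category `C` with its braiding is a modular tensor category: the braiding
is balanced and non-degenerate, i.e. the `S`-matrix is invertible. -/
structure IsModular [DecidableEq ι] : Prop where
  balanced : IsBalanced C
  nondegenerate : IsUnit (sMatrix K S)

variable [IsCompleteSimples S]

/-- The canonical map `End_TC(𝟙) = ⨁_S End(S) = ⨁_S K → F`, sending `id_S` to the class of `S`. -/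
def tubeEndToFusion : TubeHom S (𝟙_ C) (𝟙_ C) →ₗ[K] FusionAlgebra K C where
  toFun a := ∑ i, scalar K ((ρ_ (S i)).inv ≫ a i ≫ (λ_ (S i)).hom) • cls K (S i)
  map_add' a b := by
    simp only [Pi.add_apply, Preadditive.add_comp, Preadditive.comp_add, scalar_add, add_smul,
      Finset.sum_add_distrib]
  map_smul' c a := by
    simp only [Pi.smul_apply, Linear.smul_comp, Linear.comp_smul, scalar_smul, mul_smul,
      Finset.smul_sum, RingHom.id_apply]

/-- The element `𝟏_I = (d(I) / d(C)) ∑_S d(S) (S encircled by I)` of `End_TC(𝟙)`. -/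
def tubeIdempotent (i : ι) : TubeHom S (𝟙_ C) (𝟙_ C) :=
  (dim K (S i) / globalDim K S) • ∑ j, dim K (S j) •
    tubeOf K S (S j) ((ρ_ (S j)).hom ≫ encircle (S j) (S i) ≫ (λ_ (S j)).inv)

end Modular

section Spectrum

variable {K : Type w} [Field K]
variable {C : Type u} [Category.{v} C] [Abelian C] [MonoidalCategory C] [BraidedCategory C]

/-- The idempotent `e` of `F` corresponds to the point `lam` of the spectrum of `F`:
it takes the value `1` at `lam` and `0` at every other point. -/
def IsSpectralIdempotent (lam : FusionAlgebra K C →ₐ[K] K) (e : FusionAlgebra K C) : Prop :=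
  IsIdempotentElem e ∧ lam e = 1 ∧ ∀ mu : FusionAlgebra K C →ₐ[K] K, mu ≠ lam → mu e = 0

/-- A nonzero idempotent that is not a sum of two nonzero orthogonal idempotents. -/
def IsPrimitiveIdempotent {R : Type*} [CommRing R] (e : R) : Prop :=
  IsIdempotentElem e ∧ e ≠ 0 ∧ ∀ a b : R, IsIdempotentElem a → IsIdempotentElem b →
    a * b = 0 → a + b = e → a = 0 ∨ b = 0

variable [RightRigidCategory C] {ι : Type*} [Fintype ι] (S : ι → C)

/-- The inner product `⟨a, b⟩ = ∑_S a(S) b(S^∨)` on `Hom(F, K)`. -/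
def fusionInner (a b : FusionAlgebra K C →ₗ[K] K) : K :=
  ∑ i, a (cls K (S i)) * b (cls K (dual (S i)))

/-- The element `e_lam = ‖lam‖⁻² ∑_S lam(S^∨) S` of `F`. -/
def spectralIdempotent (lam : FusionAlgebra K C →ₐ[K] K) : FusionAlgebra K C :=
  (fusionInner S lam.toLinearMap lam.toLinearMap)⁻¹ • ∑ i, lam (cls K (dual (S i))) • cls K (S i)

end Spectrum

end TubeCat

end

open TubeCat

/-! Encircling a simple strand `Y` by a loop `X` is a scalar. It is additive in `X` (cut the loop
with the projectors of a direct sum) and multiplicative (a loop labelled `X ⊗ X'` is two parallel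
loops, `encircle_tensor`), so each simple `S i` gives a character `χ_i` of `F`. Closing the strand
gives `s i j = d i * χ_i [S j]`.

The rest is linear algebra with `s`, carried out in `ModularDatum`. Invertibility of `s` makes every
`d i` nonzero, the `χ_i` distinct and the classes `[S j]` a basis of `F`. Frobenius reciprocity, in
the form `N_star`, makes distinct characters orthogonal (`chi_mul_pair`), so that `s⁻¹` is an
explicit rescaling of `s` with starred rows. As `s` is symmetric, so is `s⁻¹`. Comparing its entries
with those of the unit gives `‖χ_k‖² = d(C) / d k ^ 2`, and comparing the others gives `s (star i)
(star j) = s i j`. This last symmetry turns the idempotent of `χ_{star i}` into the encircling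
formula for `𝟏_i`; accordingly `λ_I` is the character of the dual of `I`.

The graphical part provides what `ModularDatum` asks for: partial traces, `d(𝟙) = 1`, and `d(X^∨) =
d(X)` from sphericity. The tube algebra enters through `tubeEndToFusion_tubeOf`: a scalar tube on
any object `G` goes to a multiple of `[G]`, so stacking cylinders becomes the product in `F`. -/

noncomputable section

namespace TubeCat

universe w v u

attribute [local instance] Abelian.hasFiniteBiproducts

/-! ### Graphical calculus of partial traces in a pivotal category. -/

section PartialTrace

variable {C : Type u} [Category.{v} C] [MonoidalCategory C]

theorem coevaluation_rightDualIso {X Y₁ Y₂ : C} (p₁ : ExactPairing X Y₁)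
    (p₂ : ExactPairing X Y₂) :
    η_ X Y₁ ≫ X ◁ (rightDualIso p₁ p₂).hom = η_ X Y₂ := by
  have h := @coevaluation_comp_rightAdjointMate C _ _ X X ⟨Y₂⟩ ⟨Y₁⟩ (𝟙 X)
  rw [id_whiskerRight, Category.comp_id] at h
  exact h

theorem rightDualIso_evaluation {X Y₁ Y₂ : C} (p₁ : ExactPairing X Y₁)
    (p₂ : ExactPairing X Y₂) :
    (rightDualIso p₁ p₂).hom ▷ X ≫ ε_ X Y₂ = ε_ X Y₁ := by
  have h := @rightAdjointMate_comp_evaluation C _ _ X X ⟨Y₂⟩ ⟨Y₁⟩ (𝟙 X)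
  rw [whiskerLeft_id, Category.id_comp] at h
  exact h

/-- Duals are unique, so the given pairing can be compared with the one transported from the unit,
whose evaluation is visibly invertible. -/
theorem isIso_evaluation {X Y : C} (e : X ≅ 𝟙_ C) [ExactPairing X Y] : IsIso (ε_ X Y) := by
  let p := exactPairingCongrLeft (Y := 𝟙_ C) e
  rw [← rightDualIso_evaluation inferInstance p]
  have : IsIso (@ExactPairing.evaluation C _ _ X (𝟙_ C) p) :=
    inferInstanceAs (IsIso (𝟙_ C ◁ e.hom ≫ (ρ_ (𝟙_ C)).hom))
  infer_instance

variable [RightRigidCategory C]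

theorem isIso_coevaluation_unit : IsIso (η_ (𝟙_ C) (dual (𝟙_ C))) := by
  rw [← coevaluation_rightDualIso exactPairingUnit inferInstance]
  have : IsIso (@ExactPairing.coevaluation C _ _ (𝟙_ C) (𝟙_ C) exactPairingUnit) :=
    inferInstanceAs (IsIso (ρ_ (𝟙_ C)).inv)
  infer_instance

theorem coevaluation_tensor (X Y : C) :
    η_ (X ⊗ Y) (dual (X ⊗ Y)) ≫ (X ⊗ Y) ◁ (rightDualTensorIso X Y).hom =
      η_ X (dual X) ⊗≫ (X ◁ η_ Y (dual Y)) ▷ dual X ⊗≫ 𝟙 _ :=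
  coevaluation_rightDualIso _ _

theorem evaluation_tensor (X Y : C) :
    (rightDualTensorIso X Y).hom ▷ (X ⊗ Y) ≫
      (𝟙 _ ⊗≫ dual Y ◁ (ε_ X (dual X) ▷ Y) ⊗≫ ε_ Y (dual Y)) = ε_ (X ⊗ Y) (dual (X ⊗ Y)) :=
  rightDualIso_evaluation _ _

/-- The dual of a morphism of a rigid category, for the chosen duals (including that of the unit). -/
abbrev dualMap {X Y : C} (f : X ⟶ Y) : dual Y ⟶ dual X :=
  rightAdjointMate f

theorem coevaluation_comp_dualMap {X Y : C} (f : X ⟶ Y) :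
    η_ Y (dual Y) ≫ Y ◁ dualMap f = η_ X (dual X) ≫ f ▷ dual X :=
  coevaluation_comp_rightAdjointMate f

theorem coevaluation_comp_mate_evaluation (X : C) :
    η_ (𝟙_ C) (dual (𝟙_ C)) ≫
      𝟙_ C ◁ (dualMap (ε_ X (dual X)) ≫ (rightDualTensorIso (dual X) X).hom) =
      η_ (dual X) (dual (dual X)) ≫ (λ_ _).inv := by
  calc
    _ = (η_ (dual X ⊗ X) (dual (dual X ⊗ X)) ≫
        (dual X ⊗ X) ◁ (rightDualTensorIso (dual X) X).hom) ≫
          ε_ X (dual X) ▷ (dual X ⊗ dual (dual X)) := by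
      rw [whiskerLeft_comp, ← Category.assoc, coevaluation_comp_dualMap, Category.assoc,
        Category.assoc, whisker_exchange]
    _ = η_ (dual X) (dual (dual X)) ⊗≫
        (dual X ◁ η_ X (dual X) ⊗≫ ε_ X (dual X) ▷ dual X) ▷ dual (dual X) ⊗≫
          𝟙 (𝟙_ C ⊗ dual X ⊗ dual (dual X)) := by
      rw [coevaluation_tensor]; monoidal
    _ = _ := by
      rw [ExactPairing.coevaluation_evaluation'']; monoidal

variable [PivotalCategory C]

/-- Here monoidality of the pivot is used: it lets a cap on `X ⊗ Y` be drawn as two nested caps. -/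
theorem pivotalEval_tensor (X Y : C) :
    (X ⊗ Y) ◁ (rightDualTensorIso X Y).inv ≫ pivotalEval (X ⊗ Y) =
      𝟙 _ ⊗≫ X ◁ pivotalEval Y ▷ dual X ⊗≫ pivotalEval X := by
  calc
    _ = (PivotalCategory.pivot (X ⊗ Y)).hom ▷ _ ≫
        (dual (dual (X ⊗ Y)) ◁ (rightDualTensorIso X Y).inv ≫
          ε_ (dual (X ⊗ Y)) (dual (dual (X ⊗ Y)))) := by
      rw [pivotalEval, whisker_exchange_assoc]
    _ = ((PivotalCategory.pivot (X ⊗ Y)).hom ≫ doubleDualTensor X Y) ▷ _ ≫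
        (𝟙 _ ⊗≫ dual (dual X) ◁ (ε_ (dual Y) (dual (dual Y)) ▷ dual X) ⊗≫
          ε_ (dual X) (dual (dual X))) := by
      rw [← rightAdjointMate_comp_evaluation, ← evaluation_tensor, doubleDualTensor]
      simp only [comp_whiskerRight, Category.assoc]
    _ = 𝟙 _ ⊗≫ X ◁ (PivotalCategory.pivot Y).hom ▷ (dual Y ⊗ dual X) ⊗≫
        ((PivotalCategory.pivot X).hom ▷ ((dual (dual Y) ⊗ dual Y) ⊗ dual X) ≫
          dual (dual X) ◁ (ε_ (dual Y) (dual (dual Y)) ▷ dual X)) ⊗≫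
          ε_ (dual X) (dual (dual X)) := by
      rw [PivotalCategory.tensor, MonoidalCategory.tensorHom_def']
      monoidal
    _ = 𝟙 _ ⊗≫ X ◁ (PivotalCategory.pivot Y).hom ▷ (dual Y ⊗ dual X) ⊗≫
        (X ◁ (ε_ (dual Y) (dual (dual Y)) ▷ dual X) ≫
          (PivotalCategory.pivot X).hom ▷ (𝟙_ C ⊗ dual X)) ⊗≫
          ε_ (dual X) (dual (dual X)) := by
      rw [whisker_exchange]
    _ = _ := by
      rw [pivotalEval, pivotalEval]
      monoidal

theorem pivotalEval_naturality {X Y : C} (f : X ⟶ Y) :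
    f ▷ dual Y ≫ pivotalEval Y = X ◁ dualMap f ≫ pivotalEval X := by
  rw [pivotalEval, pivotalEval, whisker_exchange_assoc, ← rightAdjointMate_comp_evaluation,
    ← comp_whiskerRight_assoc, ← comp_whiskerRight_assoc, PivotalCategory.naturality]

/-- The partial trace over `X` of a morphism `A ⊗ X ⟶ B ⊗ X`. -/
def partialTrace {A B : C} (X : C) (f : A ⊗ X ⟶ B ⊗ X) : A ⟶ B :=
  (ρ_ A).inv ≫ A ◁ η_ X (dual X) ≫ (α_ A X (dual X)).inv ≫ f ▷ dual X ≫
    (α_ B X (dual X)).hom ≫ B ◁ pivotalEval X ≫ (ρ_ B).hom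

/-- The morphism `g` slides around the loop: through the cap as its dual by naturality of the pivot,
then back through the cup. -/
theorem partialTrace_cyclic {A B X Y : C} (f : A ⊗ X ⟶ B ⊗ Y) (g : Y ⟶ X) :
    partialTrace X (f ≫ B ◁ g) = partialTrace Y (A ◁ g ≫ f) := by
  calc
    _ = (ρ_ A).inv ≫ A ◁ η_ X (dual X) ≫ (α_ A X (dual X)).inv ≫ f ▷ dual X ≫
        (α_ B Y (dual X)).hom ≫ B ◁ (g ▷ dual X ≫ pivotalEval X) ≫ (ρ_ B).hom := by
      rw [partialTrace]; monoidal
    _ = (ρ_ A).inv ≫ A ◁ η_ X (dual X) ≫ (α_ A X (dual X)).inv ≫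
        (f ▷ dual X ≫ (B ⊗ Y) ◁ dualMap g) ≫
        (α_ B Y (dual Y)).hom ≫ B ◁ pivotalEval Y ≫ (ρ_ B).hom := by
      rw [pivotalEval_naturality]; monoidal
    _ = (ρ_ A).inv ≫ A ◁ (η_ X (dual X) ≫ X ◁ dualMap g) ≫ (α_ A X (dual Y)).inv ≫
        f ▷ dual Y ≫
        (α_ B Y (dual Y)).hom ≫ B ◁ pivotalEval Y ≫ (ρ_ B).hom := by
      rw [← whisker_exchange]; monoidal
    _ = _ := by
      rw [coevaluation_comp_dualMap, partialTrace]; monoidal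

theorem partialTrace_comp {A B A' B' X : C} (g : A' ⟶ A) (f : A ⊗ X ⟶ B ⊗ X) (h : B ⟶ B') :
    partialTrace X (g ▷ X ≫ f ≫ h ▷ X) = g ≫ partialTrace X f ≫ h := by
  calc
    _ = (ρ_ A').inv ≫ (A' ◁ η_ X (dual X) ≫ g ▷ (X ⊗ dual X)) ≫ (α_ A X (dual X)).inv ≫
        f ▷ dual X ≫ (α_ B X (dual X)).hom ≫ (h ▷ (X ⊗ dual X) ≫ B' ◁ pivotalEval X) ≫
        (ρ_ B').hom := by
      rw [partialTrace]; monoidal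
    _ = _ := by
      rw [whisker_exchange, ← whisker_exchange h, partialTrace]; monoidal

theorem partialTrace_whiskerLeft {A B X : C} (Z : C) (f : A ⊗ X ⟶ B ⊗ X) :
    partialTrace X ((α_ Z A X).hom ≫ Z ◁ f ≫ (α_ Z B X).inv) = Z ◁ partialTrace X f := by
  rw [partialTrace, partialTrace]; monoidal

theorem partialTrace_tensor {A B X Y : C} (f : (A ⊗ X) ⊗ Y ⟶ (B ⊗ X) ⊗ Y) :
    partialTrace (X ⊗ Y) ((α_ A X Y).inv ≫ f ≫ (α_ B X Y).hom) =
      partialTrace X (partialTrace Y f) := by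
  calc
    _ = (ρ_ A).inv ≫ A ◁ η_ (X ⊗ Y) (dual (X ⊗ Y)) ≫ (α_ A (X ⊗ Y) (dual (X ⊗ Y))).inv ≫
        (α_ A X Y).inv ▷ _ ≫ (f ▷ dual (X ⊗ Y) ≫ ((B ⊗ X) ⊗ Y) ◁ (rightDualTensorIso X Y).hom) ≫
        ((B ⊗ X) ⊗ Y) ◁ (rightDualTensorIso X Y).inv ≫ (α_ B X Y).hom ▷ _ ≫
        (α_ B (X ⊗ Y) (dual (X ⊗ Y))).hom ≫ B ◁ pivotalEval (X ⊗ Y) ≫ (ρ_ B).hom := by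
      rw [partialTrace]; simp
    _ = 𝟙 _ ⊗≫ A ◁ (η_ (X ⊗ Y) (dual (X ⊗ Y)) ≫ (X ⊗ Y) ◁ (rightDualTensorIso X Y).hom) ⊗≫
        f ▷ (dual Y ⊗ dual X) ⊗≫
        B ◁ ((X ⊗ Y) ◁ (rightDualTensorIso X Y).inv ≫ pivotalEval (X ⊗ Y)) ⊗≫ 𝟙 _ := by
      rw [← whisker_exchange]; monoidal
    _ = _ := by
      rw [coevaluation_tensor, pivotalEval_tensor, partialTrace, partialTrace]
      monoidal

theorem rightTrace_eq_partialTrace {X : C} (f : X ⟶ X) :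
    rightTrace f = partialTrace X (𝟙_ C ◁ f) := by
  rw [partialTrace, rightTrace]; monoidal

theorem rightTrace_tensor {X Y : C} (f : X ⊗ Y ⟶ X ⊗ Y) :
    rightTrace f = rightTrace (partialTrace Y f) := by
  have h : 𝟙_ C ◁ f = (α_ _ _ _).inv ≫ ((α_ _ _ _).hom ≫ 𝟙_ C ◁ f ≫ (α_ _ _ _).inv) ≫
      (α_ _ _ _).hom := by simp
  rw [rightTrace_eq_partialTrace, h, partialTrace_tensor, partialTrace_whiskerLeft,
    rightTrace_eq_partialTrace]

theorem rightTrace_comp_comm {X Y : C} (f : X ⟶ Y) (g : Y ⟶ X) :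
    rightTrace (f ≫ g) = rightTrace (g ≫ f) := by
  rw [rightTrace_eq_partialTrace, rightTrace_eq_partialTrace, whiskerLeft_comp,
    partialTrace_cyclic, whiskerLeft_comp]

/-- This is `d(𝟙) = d(𝟙 ⊗ 𝟙) = d(𝟙)²`. -/
theorem rightTrace_id_unit_comp_self :
    rightTrace (𝟙 (𝟙_ C)) ≫ rightTrace (𝟙 (𝟙_ C)) = rightTrace (𝟙 (𝟙_ C)) := by
  have h1 : rightTrace (𝟙 (𝟙_ C ⊗ 𝟙_ C)) = rightTrace (𝟙 (𝟙_ C)) := by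
    have h := rightTrace_comp_comm (λ_ (𝟙_ C)).hom (λ_ (𝟙_ C)).inv
    simpa using h
  have h2 : partialTrace (𝟙_ C) (𝟙 (𝟙_ C ⊗ 𝟙_ C)) = rightTrace (𝟙 (𝟙_ C)) := by
    rw [rightTrace_eq_partialTrace, whiskerLeft_id]
  have h3 (f : 𝟙_ C ⟶ 𝟙_ C) : rightTrace f = f ≫ rightTrace (𝟙 (𝟙_ C)) := by
    have : 𝟙_ C ◁ f = f ▷ 𝟙_ C ≫ 𝟙_ C ◁ 𝟙 (𝟙_ C) ≫ 𝟙 (𝟙_ C) ▷ 𝟙_ C := by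
      simp [id_whiskerLeft, whiskerRight_id, unitors_equal, unitors_inv_equal]
    rw [rightTrace_eq_partialTrace, this, partialTrace_comp, ← rightTrace_eq_partialTrace,
      Category.comp_id]
  rw [← h3]
  conv_rhs => rw [← h1, rightTrace_tensor, h2]

/-- The trace is idempotent, and it is invertible because the cup and cap of the unit are; hence it
is the identity. -/
theorem rightTrace_id_unit : rightTrace (𝟙 (𝟙_ C)) = 𝟙 (𝟙_ C) := by
  have h1 : IsIso (η_ (𝟙_ C) (dual (𝟙_ C))) := isIso_coevaluation_unit
  have : IsIso (ε_ (dual (𝟙_ C)) (dual (dual (𝟙_ C)))) :=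
    isIso_evaluation ((λ_ _).symm ≪≫ (asIso (η_ (𝟙_ C) (dual (𝟙_ C)))).symm)
  have : IsIso (rightTrace (𝟙 (𝟙_ C))) := by
    rw [rightTrace, pivotalEval]
    infer_instance
  rw [← cancel_mono (rightTrace (𝟙 (𝟙_ C))), rightTrace_id_unit_comp_self, Category.id_comp]

/-- This plays the role of the identity saying that the pivot of `dual X` is inverse to the dual of
the pivot of `X`. -/
theorem evaluation_eq_pivotalEval (X : C) :
    ε_ X (dual X) = 𝟙 _ ⊗≫ (dual X ⊗ X) ◁ η_ (dual X) (dual (dual X)) ⊗≫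
      dual X ◁ pivotalEval X ▷ dual (dual X) ⊗≫ pivotalEval (dual X) := by
  calc
    -- Insert a trivial loop labelled by the unit; sliding the evaluation around it turns it into
    -- its dual, which is the coevaluation of `dual X`.
    _ = ε_ X (dual X) ≫ rightTrace (𝟙 (𝟙_ C)) := by
      rw [rightTrace_id_unit, Category.comp_id]
    _ = (ρ_ _).inv ≫ (ε_ X (dual X) ▷ 𝟙_ C ≫
        𝟙_ C ◁ (η_ (𝟙_ C) (dual (𝟙_ C)) ≫ (λ_ _).hom)) ≫ pivotalEval (𝟙_ C) := by
      rw [rightTrace]; monoidal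
    _ = (ρ_ _).inv ≫ (dual X ⊗ X) ◁ (η_ (𝟙_ C) (dual (𝟙_ C)) ≫ (λ_ _).hom) ≫
        ε_ X (dual X) ▷ dual (𝟙_ C) ≫ pivotalEval (𝟙_ C) := by
      rw [← whisker_exchange, Category.assoc]
    _ = (ρ_ _).inv ≫ (dual X ⊗ X) ◁ (η_ (𝟙_ C) (dual (𝟙_ C)) ≫ (λ_ _).hom) ≫
        (dual X ⊗ X) ◁ (dualMap (ε_ X (dual X)) ≫
          (rightDualTensorIso (dual X) X).hom ≫ (rightDualTensorIso (dual X) X).inv) ≫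
          pivotalEval (dual X ⊗ X) := by
      rw [pivotalEval_naturality, Iso.hom_inv_id, Category.comp_id]
    _ = (ρ_ _).inv ≫ (dual X ⊗ X) ◁ (η_ (𝟙_ C) (dual (𝟙_ C)) ≫
        𝟙_ C ◁ (dualMap (ε_ X (dual X)) ≫ (rightDualTensorIso (dual X) X).hom)) ≫
        (dual X ⊗ X) ◁ (λ_ _).hom ≫
        ((dual X ⊗ X) ◁ (rightDualTensorIso (dual X) X).inv ≫ pivotalEval (dual X ⊗ X)) := by
      simp
    _ = _ := by
      rw [coevaluation_comp_mate_evaluation, pivotalEval_tensor]; monoidal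

theorem leftTrace_id_eq_rightTrace_id_dual (X : C) :
    leftTrace (𝟙 X) = rightTrace (𝟙 (dual X)) := by
  calc
    _ = η_ (dual X) (dual (dual X)) ⊗≫
        dual X ◁ ((PivotalCategory.pivot X).inv ▷ 𝟙_ C ≫
          X ◁ η_ (dual X) (dual (dual X))) ⊗≫
        dual X ◁ pivotalEval X ▷ dual (dual X) ⊗≫ pivotalEval (dual X) := by
      rw [leftTrace, evaluation_eq_pivotalEval]; monoidal
    _ = η_ (dual X) (dual (dual X)) ⊗≫
        dual X ◁ (dual (dual X) ◁ η_ (dual X) (dual (dual X)) ⊗≫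
          ((PivotalCategory.pivot X).inv ≫ (PivotalCategory.pivot X).hom) ▷ dual X ▷ dual (dual X) ⊗≫
          ε_ (dual X) (dual (dual X)) ▷ dual (dual X)) ⊗≫ pivotalEval (dual X) := by
      rw [← whisker_exchange, pivotalEval]; monoidal
    _ = η_ (dual X) (dual (dual X)) ⊗≫
        dual X ◁ (dual (dual X) ◁ η_ (dual X) (dual (dual X)) ⊗≫
          ε_ (dual X) (dual (dual X)) ▷ dual (dual X)) ⊗≫ pivotalEval (dual X) := by
      rw [Iso.inv_hom_id]; monoidal
    _ = _ := by
      rw [ExactPairing.coevaluation_evaluation'', rightTrace]; monoidal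

end PartialTrace

/-! ### Double braidings and encircling loops. -/

section DoubleBraiding

variable {C : Type u} [Category.{v} C] [MonoidalCategory C] [BraidedCategory C]

theorem doubleBraiding_naturality {X X' Y Y' : C} (f : X ⟶ X') (g : Y ⟶ Y') :
    (f ⊗ₘ g) ≫ doubleBraiding X' Y' = doubleBraiding X Y ≫ (f ⊗ₘ g) := by
  simp [doubleBraiding]

theorem doubleBraiding_tensor_right (Y X X' : C) :
    doubleBraiding Y (X ⊗ X') = (α_ Y X X').inv ≫
      ((β_ Y X).hom ▷ X' ≫ ((α_ X Y X').hom ≫ X ◁ doubleBraiding Y X' ≫ (α_ X Y X').inv) ≫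
        (β_ X Y).hom ▷ X') ≫ (α_ Y X X').hom := by
  simp [doubleBraiding, BraidedCategory.braiding_tensor_right_hom,
    BraidedCategory.braiding_tensor_left_hom]

end DoubleBraiding

section Encircle

variable {C : Type u} [Category.{v} C] [MonoidalCategory C] [RightRigidCategory C]
  [PivotalCategory C] [BraidedCategory C]

theorem encircle_eq_partialTrace (Y X : C) :
    encircle Y X = partialTrace X (doubleBraiding Y X) :=
  rfl

theorem encircle_naturality {Y Y' : C} (f : Y ⟶ Y') (X : C) :
    f ≫ encircle Y' X = encircle Y X ≫ f := by
  have h := doubleBraiding_naturality f (𝟙 X)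
  rw [tensorHom_id] at h
  have h1 := partialTrace_comp f (doubleBraiding Y' X) (𝟙 Y')
  have h2 := partialTrace_comp (𝟙 Y) (doubleBraiding Y X) f
  rw [encircle_eq_partialTrace, encircle_eq_partialTrace]
  simpa [h] using h1.symm.trans (by simpa [h] using h2)

theorem encircle_eq_of_iso (Y : C) {X X' : C} (e : X ≅ X') : encircle Y X = encircle Y X' := by
  have h := doubleBraiding_naturality (𝟙 Y) e.hom
  rw [id_tensorHom] at h
  have h1 := partialTrace_cyclic (doubleBraiding Y X ≫ Y ◁ e.hom) e.inv
  rw [← h, whiskerLeft_inv_hom_assoc, h, Category.assoc, whiskerLeft_hom_inv,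
    Category.comp_id] at h1
  exact h1

/-- A loop carrying the projector onto a summand is a loop of that summand; this is what gives
additivity. -/
theorem partialTrace_doubleBraiding_retract (Y : C) {X Z : C} (i : X ⟶ Z) (p : Z ⟶ X)
    (h : i ≫ p = 𝟙 X) :
    partialTrace Z (doubleBraiding Y Z ≫ Y ◁ (p ≫ i)) = encircle Y X := by
  have hn := doubleBraiding_naturality (𝟙 Y) p
  rw [id_tensorHom] at hn
  rw [whiskerLeft_comp, ← Category.assoc, partialTrace_cyclic, ← hn, ← whiskerLeft_comp_assoc, h,
    whiskerLeft_id, Category.id_comp, encircle_eq_partialTrace]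

/-- By the hexagons the `X'` loop sits inside the `X` loop. Once closed it is an endomorphism of
`Y`, and it slides past the crossing with `X` by naturality of the braiding. -/
theorem encircle_tensor (Y X X' : C) :
    encircle Y (X ⊗ X') = encircle Y X ≫ encircle Y X' := by
  rw [encircle_eq_partialTrace, doubleBraiding_tensor_right, partialTrace_tensor,
    partialTrace_comp, partialTrace_whiskerLeft, ← encircle_eq_partialTrace,
    BraidedCategory.braiding_naturality_right, ← Category.assoc, ← doubleBraiding]
  have h := partialTrace_comp (𝟙 Y) (doubleBraiding Y X) (encircle Y X')
  simpa [encircle_eq_partialTrace Y X] using h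

theorem rightTrace_doubleBraiding (X Y : C) :
    rightTrace (doubleBraiding X Y) = rightTrace (encircle X Y) := by
  rw [rightTrace_tensor, encircle_eq_partialTrace]

theorem rightTrace_doubleBraiding_comm (X Y : C) :
    rightTrace (doubleBraiding X Y) = rightTrace (doubleBraiding Y X) :=
  rightTrace_comp_comm _ _

theorem encircle_unit_left (X : C) : encircle (𝟙_ C) X = rightTrace (𝟙 X) := by
  rw [rightTrace_eq_partialTrace, encircle_eq_partialTrace]
  simp [doubleBraiding]

theorem encircle_unit_right (Y : C) : encircle Y (𝟙_ C) = 𝟙 Y := by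
  have h : doubleBraiding Y (𝟙_ C) = 𝟙 _ := by simp [doubleBraiding]
  calc
    _ = (ρ_ Y).inv ≫ Y ◁ rightTrace (𝟙 (𝟙_ C)) ≫ (ρ_ Y).hom := by
      rw [encircle_eq_partialTrace, h, partialTrace, rightTrace]; monoidal
    _ = 𝟙 Y := by
      rw [rightTrace_id_unit]; simp

end Encircle

/-! ### Characters and idempotents determined by an abstract `S`-matrix. -/

section Characters

variable {K A ι : Type*} [Field K] [CommRing A] [Algebra K A] [Fintype ι] [DecidableEq ι]

/-- A commutative algebra with a spanning family `b` (indexed by `ι`, with an involution `star` and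
a unit `o`) whose structure constants have the symmetry of fusion coefficients, together with
characters `chi` related to a symmetric invertible matrix `s` by `s i j = d i * chi i (b j)`. -/
structure ModularDatum (K A ι : Type*) [Field K] [CommRing A] [Algebra K A] [Fintype ι]
    [DecidableEq ι] where
  b : ι → A
  span_b : ∀ x : A, ∃ c : ι → K, x = ∑ j, c j • b j
  chi : ι → A →ₐ[K] K
  d : ι → K
  s : Matrix ι ι K
  s_apply : ∀ i j, s i j = d i * chi i (b j)
  s_symm : ∀ i j, s i j = s j i
  isUnit_s : IsUnit s
  star : ι → ι
  star_star : ∀ i, star (star i) = i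
  d_star : ∀ i, d (star i) = d i
  o : ι
  star_o : star o = o
  b_o : b o = 1
  chi_o : ∀ j, chi o (b j) = d j
  N : ι → ι → ι → K
  b_mul_b : ∀ i j, b i * b j = ∑ t, N i j t • b t
  N_star : ∀ i j t, N i (star t) (star j) = N i j t

namespace ModularDatum

variable (M : ModularDatum K A ι)

/-- The involution `star` as a permutation. -/
def starEquiv : ι ≃ ι := ⟨M.star, M.star, M.star_star, M.star_star⟩

theorem s_mul_inv : M.s * M.s⁻¹ = 1 :=
  Matrix.mul_nonsing_inv _ ((Matrix.isUnit_iff_isUnit_det _).1 M.isUnit_s)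

theorem inv_mul_s : M.s⁻¹ * M.s = 1 :=
  Matrix.nonsing_inv_mul _ ((Matrix.isUnit_iff_isUnit_det _).1 M.isUnit_s)

theorem mul_sum_chi_inv (i j : ι) :
    M.d i * ∑ k, M.chi i (M.b k) * M.s⁻¹ k j = if i = j then 1 else 0 := by
  have h := congrFun (congrFun M.s_mul_inv i) j
  rw [Matrix.mul_apply, Matrix.one_apply] at h
  rw [← h, Finset.mul_sum]
  exact Finset.sum_congr rfl fun k _ => by rw [M.s_apply, mul_assoc]

theorem d_ne_zero (i : ι) : M.d i ≠ 0 := by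
  intro h
  have := M.mul_sum_chi_inv i i
  rw [h, zero_mul, if_pos rfl] at this
  exact zero_ne_one this

theorem eq_zero_of_chi {c : ι → K} (h : ∀ i, M.chi i (∑ j, c j • M.b j) = 0) : c = 0 := by
  have h0 : M.s.mulVec c = 0 := by
    ext i
    have := h i
    rw [map_sum] at this
    simp only [map_smul, smul_eq_mul] at this
    rw [Matrix.mulVec, dotProduct, Pi.zero_apply, ← mul_zero (M.d i), ← this, Finset.mul_sum]
    exact Finset.sum_congr rfl fun k _ => by rw [M.s_apply]; ring
  rw [← Matrix.one_mulVec c, ← M.inv_mul_s, ← Matrix.mulVec_mulVec, h0, Matrix.mulVec_zero]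

/-- The `chi i` separate points, so identities in the algebra below are checked character by
character. -/
theorem ext_of_chi {x y : A} (h : ∀ i, M.chi i x = M.chi i y) : x = y := by
  obtain ⟨c, hc⟩ := M.span_b (x - y)
  have hc0 : c = 0 := M.eq_zero_of_chi fun i => by rw [← hc, map_sub, h, sub_self]
  rw [← sub_eq_zero, hc, hc0]
  simp

theorem linearIndependent_b {c : ι → K} (h : ∑ j, c j • M.b j = 0) : c = 0 :=
  M.eq_zero_of_chi fun i => by rw [h, map_zero]

/-- The pairing of two characters. -/
def pair (i j : ι) : K := ∑ k, M.chi i (M.b k) * M.chi j (M.b (M.star k))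

/-- Multiplication by `b x` is self-adjoint for the pairing up to `star`, so it can be moved from
one character to the other; orthogonality of distinct characters follows. -/
theorem chi_mul_pair (i j x : ι) :
    M.chi i (M.b x) * M.pair i j = M.chi j (M.b x) * M.pair i j := by
  have h1 : M.chi i (M.b x) * M.pair i j =
      ∑ k, ∑ t, M.N x k t * (M.chi i (M.b t) * M.chi j (M.b (M.star k))) := by
    rw [pair, Finset.mul_sum]
    refine Finset.sum_congr rfl fun k _ => ?_
    rw [← mul_assoc, ← map_mul, M.b_mul_b, map_sum, Finset.sum_mul]
    exact Finset.sum_congr rfl fun t _ => by rw [map_smul, smul_eq_mul, mul_assoc]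
  have h2 : M.chi j (M.b x) * M.pair i j =
      ∑ t, ∑ k, M.N x k t * (M.chi i (M.b t) * M.chi j (M.b (M.star k))) := by
    rw [pair, Finset.mul_sum]
    refine Finset.sum_congr rfl fun t _ => ?_
    -- Replacing the summation index by its `star` brings the coefficient into the form of `N_star`.
    rw [mul_left_comm, ← map_mul, M.b_mul_b, map_sum, Finset.mul_sum,
      ← Equiv.sum_comp M.starEquiv]
    refine Finset.sum_congr rfl fun k _ => ?_
    change _ * M.chi j (M.N x (M.star t) (M.star k) • M.b (M.star k)) = _
    rw [M.N_star, map_smul, smul_eq_mul, mul_left_comm]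
  rw [h1, h2, Finset.sum_comm]

theorem chi_injective : Function.Injective M.chi := by
  intro i j h
  by_contra hij
  have h1 := M.mul_sum_chi_inv i i
  have h2 := M.mul_sum_chi_inv j i
  rw [if_pos rfl] at h1
  rw [if_neg (Ne.symm hij), ← h] at h2
  rw [(mul_eq_zero.1 h2).resolve_left (M.d_ne_zero j), mul_zero] at h1
  exact zero_ne_one h1

theorem pair_of_ne {i j : ι} (hij : i ≠ j) : M.pair i j = 0 := by
  by_contra h
  refine hij (M.chi_injective (AlgHom.ext fun x => ?_))
  obtain ⟨c, rfl⟩ := M.span_b x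
  simp only [map_sum, map_smul]
  exact Finset.sum_congr rfl fun k _ => by rw [mul_right_cancel₀ h (M.chi_mul_pair i j k)]

theorem sum_s_mul_s_star (i j : ι) :
    ∑ k, M.s i k * M.s j (M.star k) = M.d i * M.d j * M.pair i j := by
  rw [pair, Finset.mul_sum]
  exact Finset.sum_congr rfl fun k _ => by rw [M.s_apply, M.s_apply]; ring

/-- Otherwise the starred row `i` of `s` would be orthogonal to every row of `s`, hence zero; but
its entry at the unit is `d i`. -/
theorem pair_self_ne_zero (i : ι) : M.pair i i ≠ 0 := by
  intro h
  have h0 : M.s.mulVec (fun k => M.s i (M.star k)) = 0 := by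
    ext j
    rw [Matrix.mulVec, dotProduct, M.sum_s_mul_s_star j i]
    rcases eq_or_ne j i with rfl | hji
    · rw [h, mul_zero, Pi.zero_apply]
    · rw [M.pair_of_ne hji, mul_zero, Pi.zero_apply]
  have h1 : (fun k => M.s i (M.star k)) = 0 := by
    rw [← Matrix.one_mulVec (fun k => M.s i (M.star k)), ← M.inv_mul_s, ← Matrix.mulVec_mulVec,
      h0, Matrix.mulVec_zero]
  have h2 := congrFun h1 M.o
  rw [M.star_o, M.s_apply, M.b_o, map_one, mul_one] at h2
  exact M.d_ne_zero i h2

/-- The inverse of the matrix `s`. -/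
theorem inv_s_apply (k j : ι) :
    M.s⁻¹ k j = M.s (M.star k) j / (M.d j ^ 2 * M.pair j j) := by
  have hne : ∀ j, M.d j ^ 2 * M.pair j j ≠ 0 := fun j =>
    mul_ne_zero (pow_ne_zero _ (M.d_ne_zero j)) (M.pair_self_ne_zero j)
  have h : M.s * Matrix.of (fun k j => M.s (M.star k) j / (M.d j ^ 2 * M.pair j j)) = 1 := by
    ext i j
    rw [Matrix.mul_apply, Matrix.one_apply]
    have : ∑ k, M.s i k * (M.s (M.star k) j / (M.d j ^ 2 * M.pair j j)) =
        (∑ k, M.s i k * M.s j (M.star k)) / (M.d j ^ 2 * M.pair j j) := by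
      rw [Finset.sum_div]
      exact Finset.sum_congr rfl fun k _ => by rw [M.s_symm j, mul_div_assoc]
    simp only [Matrix.of_apply, this, M.sum_s_mul_s_star]
    rcases eq_or_ne i j with rfl | hij
    · rw [if_pos rfl, ← sq, div_self (hne i)]
    · rw [if_neg hij, M.pair_of_ne hij, mul_zero, zero_div]
  rw [Matrix.inv_eq_right_inv h, Matrix.of_apply]

theorem inv_s_symm (k j : ι) : M.s⁻¹ k j = M.s⁻¹ j k := by
  have h : M.s.transpose = M.s := by
    ext i j
    exact M.s_symm j i
  conv_lhs => rw [← h, ← Matrix.transpose_nonsing_inv, Matrix.transpose_apply]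

theorem d_o : M.d M.o = 1 := by
  rw [← M.chi_o, M.b_o, map_one]

theorem s_o_right (k : ι) : M.s k M.o = M.d k := by
  rw [M.s_apply, M.b_o, map_one, mul_one]

theorem pair_o_o : M.pair M.o M.o = ∑ k, M.d k ^ 2 :=
  Finset.sum_congr rfl fun k _ => by rw [M.chi_o, M.chi_o, M.d_star, sq]

/-- Symmetry of `s⁻¹` at the entries `(k, o)` and `(o, k)`, after cancelling `d k`. -/
theorem d_sq_mul_pair (k : ι) : M.d k ^ 2 * M.pair k k = ∑ k, M.d k ^ 2 := by
  have h := M.inv_s_symm k M.o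
  rw [M.inv_s_apply, M.inv_s_apply, M.star_o, M.s_symm M.o k, M.s_o_right, M.s_o_right,
    M.d_star, M.d_o, one_pow, one_mul, M.pair_o_o] at h
  have h0 : M.pair M.o M.o ≠ 0 := M.pair_self_ne_zero _
  rw [M.pair_o_o] at h0
  rw [div_eq_div_iff h0 (mul_ne_zero (pow_ne_zero _ (M.d_ne_zero k)) (M.pair_self_ne_zero k))] at h
  exact mul_left_cancel₀ (M.d_ne_zero k) h

theorem sum_d_sq_ne_zero : ∑ k, M.d k ^ 2 ≠ 0 := by
  rw [← M.pair_o_o]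
  exact M.pair_self_ne_zero _

theorem pair_self (i : ι) : M.pair i i = (∑ k, M.d k ^ 2) / M.d i ^ 2 := by
  rw [eq_div_iff (pow_ne_zero _ (M.d_ne_zero i)), mul_comm, M.d_sq_mul_pair]

theorem s_star_star (i j : ι) : M.s (M.star i) (M.star j) = M.s i j := by
  -- All denominators in `inv_s_apply` are the same constant, so symmetry of `s⁻¹` passes to the
  -- starred matrix.
  have h := M.inv_s_symm i (M.star j)
  rw [M.inv_s_apply, M.inv_s_apply, M.star_star, M.d_sq_mul_pair, M.d_sq_mul_pair,
    div_left_inj' M.sum_d_sq_ne_zero] at h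
  rw [h, M.s_symm]

/-- The idempotent of the algebra that corresponds to the character `chi i`. -/
def idem (i : ι) : A := (M.pair i i)⁻¹ • ∑ k, M.chi i (M.b (M.star k)) • M.b k

/-- The idempotent of `chi (star i)`, in terms of the matrix `s`. -/
theorem idem_star (i : ι) : M.idem (M.star i) =
    (M.d i / ∑ k, M.d k ^ 2) • ∑ j, M.d j • M.chi j (M.b i) • M.b j := by
  rw [idem, M.pair_self, M.d_star, Finset.smul_sum, Finset.smul_sum]
  refine Finset.sum_congr rfl fun j _ => ?_
  have h : M.d i * M.chi (M.star i) (M.b (M.star j)) = M.d j * M.chi j (M.b i) := by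
    rw [← M.d_star i, ← M.s_apply, M.s_star_star, M.s_symm, M.s_apply]
  rw [smul_smul (M.d j), ← h, smul_smul, smul_smul]
  congr 1
  rw [inv_div]
  ring

theorem chi_idem (i j : ι) : M.chi j (M.idem i) = if j = i then 1 else 0 := by
  have : M.chi j (M.idem i) = (M.pair i i)⁻¹ * M.pair j i := by
    rw [idem, map_smul, map_sum, smul_eq_mul, pair]
    congr 1
    exact Finset.sum_congr rfl fun k _ => by rw [map_smul, smul_eq_mul, mul_comm]
  rw [this]
  split_ifs with h
  · rw [h, inv_mul_cancel₀ (M.pair_self_ne_zero i)]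
  · rw [M.pair_of_ne h, mul_zero]

theorem isIdempotentElem_idem (i : ι) : IsIdempotentElem (M.idem i) :=
  M.ext_of_chi fun j => by
    rw [map_mul, M.chi_idem]
    split_ifs <;> simp

theorem mul_idem (x : A) (i : ι) : x * M.idem i = M.chi i x • M.idem i :=
  M.ext_of_chi fun j => by
    rw [map_mul, map_smul, M.chi_idem]
    split_ifs with h
    · rw [h, smul_eq_mul]
    · rw [mul_zero, smul_zero]

theorem sum_idem : ∑ i, M.idem i = 1 :=
  M.ext_of_chi fun j => by
    rw [map_sum, map_one]
    simp [M.chi_idem]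

/-- Since the idempotents sum to 1, some `mu (idem i)` is nonzero; applying `mu` to `x * idem i =
chi i x • idem i` forces `mu = chi i`. -/
theorem chi_surjective : Function.Surjective M.chi := by
  intro mu
  obtain ⟨i, hi⟩ : ∃ i, mu (M.idem i) ≠ 0 := by
    by_contra! h
    have := congrArg mu M.sum_idem
    rw [map_sum, map_one, Finset.sum_eq_zero fun i _ => h i] at this
    exact zero_ne_one this
  refine ⟨i, AlgHom.ext fun x => mul_right_cancel₀ hi ?_⟩
  rw [← map_mul mu, M.mul_idem, map_smul, smul_eq_mul]

theorem spectral_iff_eq_idem (i : ι) (e : A) :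
    (IsIdempotentElem e ∧ M.chi i e = 1 ∧ ∀ mu : A →ₐ[K] K, mu ≠ M.chi i → mu e = 0) ↔
      e = M.idem i := by
  constructor
  · rintro ⟨-, h1, h2⟩
    refine M.ext_of_chi fun j => ?_
    rw [M.chi_idem]
    split_ifs with h
    · rw [h, h1]
    · exact h2 _ fun hji => h (M.chi_injective hji)
  · rintro rfl
    refine ⟨M.isIdempotentElem_idem i, by rw [M.chi_idem, if_pos rfl], fun mu hmu => ?_⟩
    obtain ⟨j, rfl⟩ := M.chi_surjective mu
    rw [M.chi_idem, if_neg (fun hji => hmu (congrArg M.chi hji))]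

theorem isPrimitiveIdempotent_idem (i : ι) : IsPrimitiveIdempotent (M.idem i) := by
  -- A summand satisfies `a = a * idem i = chi i a • idem i`, so it vanishes as soon as `chi i`
  -- kills it.
  have key : ∀ a b : A, IsIdempotentElem a → a * b = 0 → a + b = M.idem i →
      M.chi i a = 0 → a = 0 := by
    intro a b ha hab habi h
    have h1 : a = a * M.idem i := by rw [← habi, mul_add, hab, add_zero, ha.eq]
    rw [h1, M.mul_idem, h, zero_smul]
  refine ⟨M.isIdempotentElem_idem i, fun h => ?_, fun a b ha hb hab habi => ?_⟩
  · have := M.chi_idem i i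
    rw [h, map_zero, if_pos rfl] at this
    exact zero_ne_one this
  · have h : M.chi i a * M.chi i b = 0 := by rw [← map_mul, hab, map_zero]
    rcases mul_eq_zero.1 h with h | h
    · exact Or.inl (key a b ha hab habi h)
    · exact Or.inr (key b a hb (by rw [mul_comm, hab]) (by rw [add_comm, habi]) h)

end ModularDatum

end Characters

/-! ### Classes of objects in the fusion algebra. -/

section Cls

variable (K : Type w) [Field K]
variable {C : Type u} [Category.{v} C] [Abelian C] [MonoidalCategory C] [BraidedCategory C]

theorem cls_eq_of_iso {X Y : C} (e : X ≅ Y) : cls K X = cls K Y := by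
  rw [cls, cls, congr_toSkeleton_of_iso e]

theorem cls_unit : cls K (𝟙_ C) = 1 := by
  rw [cls, ← Skeleton.one_eq, map_one, map_one, Algebra.TensorProduct.one_def]

theorem cls_tensor (X Y : C) : cls K (X ⊗ Y) = cls K X * cls K Y := by
  rw [cls, cls, cls, Skeleton.toSkeleton_tensorObj, map_mul, map_mul,
    Algebra.TensorProduct.tmul_mul_tmul, one_mul]

theorem cls_biprod (X Y : C) : cls K (X ⊞ Y) = cls K X + cls K Y := by
  rw [cls, cls, cls, ← TensorProduct.tmul_add, ← map_add]
  congr 1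
  exact Ideal.Quotient.eq.2 (Ideal.subset_span ⟨X, Y, rfl⟩)

theorem cls_of_isZero {X : C} (h : IsZero X) : cls K X = 0 := by
  have h1 : X ⊞ X ≅ X := (biprod_isZero_iff X X |>.2 ⟨h, h⟩).iso h
  have h2 := (cls_biprod K X X).symm.trans (cls_eq_of_iso K h1)
  exact left_eq_add.1 h2.symm

/-- A biproduct over `Fin (n + 1)` is the biproduct of its first summand and of the others. -/
def biproductFinSucc {n : ℕ} (s : Fin (n + 1) → C) : ⨁ s ≅ s 0 ⊞ ⨁ fun k : Fin n => s k.succ where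
  hom := biprod.lift (biproduct.π s 0) (biproduct.lift fun k => biproduct.π s k.succ)
  inv := biprod.desc (biproduct.ι s 0) (biproduct.desc fun k => biproduct.ι s k.succ)
  hom_inv_id := by
    rw [biprod.lift_desc, biproduct.lift_desc, ← biproduct.total, Fin.sum_univ_succ]
  inv_hom_id := by
    ext k l
    · simp
    · simp [biproduct.ι_π_ne _ (Fin.succ_ne_zero _).symm]
    · simp [biproduct.ι_π_ne _ (Fin.succ_ne_zero _)]
    · rcases eq_or_ne k l with rfl | h
      · simp
      · simp [biproduct.ι_π_ne _ h, biproduct.ι_π_ne _ (fun h' => h (Fin.succ_injective _ h'))]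

theorem cls_biproduct {n : ℕ} (s : Fin n → C) : cls K (⨁ s) = ∑ k, cls K (s k) := by
  induction n with
  | zero =>
    rw [Finset.univ_eq_empty, Finset.sum_empty]
    refine cls_of_isZero K ((IsZero.iff_id_eq_zero _).2 ?_)
    ext k
    exact k.elim0
  | succ n ih =>
    rw [cls_eq_of_iso K (biproductFinSucc s), cls_biprod, ih, Fin.sum_univ_succ]

theorem fusionAlgebra_induction {p : FusionAlgebra K C → Prop} (zero : p 0)
    (add : ∀ x y, p x → p y → p (x + y)) (smul : ∀ (c : K) (X : C), p (c • cls K X))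
    (x : FusionAlgebra K C) : p x := by
  induction x using TensorProduct.induction_on with
  | zero => exact zero
  | add x y hx hy => exact add x y hx hy
  | tmul c y =>
    obtain ⟨m, rfl⟩ := Ideal.Quotient.mk_surjective y
    induction m using MonoidAlgebra.induction_linear with
    | zero => rw [map_zero, TensorProduct.tmul_zero]; exact zero
    | add f g hf hg => rw [map_add, TensorProduct.tmul_add]; exact add _ _ hf hg
    | single X n =>
      have : c ⊗ₜ[ℤ] Ideal.Quotient.mk (grothendieckRelations C) (MonoidAlgebra.single X n) =
          (n • c) • cls K X.out := by
        have h : toSkeleton (Quotient.out X) = X := Quotient.out_eq X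
        rw [cls, h, MonoidAlgebra.of_apply, TensorProduct.smul_tmul', smul_eq_mul, mul_one,
          TensorProduct.smul_tmul, ← map_zsmul, MonoidAlgebra.smul_single, smul_eq_mul, mul_one]
      rw [this]
      exact smul _ _

end Cls

/-! ### Decomposition into simple objects and multiplicities. -/

section HomLinear

variable (K : Type w) [Field K]
variable {C : Type u} [Category.{v} C] [Preadditive C] [Linear K C]

/-- Composition with an isomorphism, as a linear map. -/
def homCongrLinear {X X' Y Y' : C} (e : X ≅ X') (f : Y ≅ Y') : (X ⟶ Y) ≃ₗ[K] (X' ⟶ Y') where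
  toFun g := e.inv ≫ g ≫ f.hom
  invFun g := e.hom ≫ g ≫ f.inv
  map_add' g h := by simp
  map_smul' c g := by simp
  left_inv g := by simp
  right_inv g := by simp

end HomLinear

section Decomposition

variable (K : Type w) [Field K]
variable {C : Type u} [Category.{v} C] [Abelian C] [Linear K C]

/-- Morphisms into a biproduct are families of morphisms. -/
def homBiproductEquiv (X : C) {n : ℕ} (s : Fin n → C) : (X ⟶ ⨁ s) ≃ₗ[K] ∀ k, X ⟶ s k where
  toFun f k := f ≫ biproduct.π s k
  invFun f := biproduct.lift f
  map_add' f g := by ext; simp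
  map_smul' c f := by ext; simp
  left_inv f := by ext; simp
  right_inv f := by ext; simp

variable [MonoidalCategory C] [IsFusionCategory K C]

/-- Each simple summand of `X` contributes at least one dimension to `End(X)`, so there is exactly
one. -/
theorem simple_of_finrank_end_eq_one {X : C} (h : Module.finrank K (X ⟶ X) = 1) : Simple X := by
  classical
  obtain ⟨n, s, hs, ⟨e⟩⟩ := IsFusionCategory.semisimple (K := K) X
  have hle (k : Fin n) : 1 ≤ Module.finrank K (X ⟶ s k) := by
    refine Module.finrank_pos_iff_exists_ne_zero.2 ⟨e.hom ≫ biproduct.π s k, fun h0 => ?_⟩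
    have : biproduct.ι s k ≫ e.inv ≫ e.hom ≫ biproduct.π s k = 𝟙 (s k) := by simp
    rw [h0, comp_zero, comp_zero] at this
    exact id_nonzero (s k) this.symm
  have hX := ((homCongrLinear K (Iso.refl X) e).trans (homBiproductEquiv K X s)).finrank_eq
  rw [h, Module.finrank_pi_fintype] at hX
  have hn : n ≤ 1 := by
    rw [hX]
    calc n = ∑ _k : Fin n, 1 := by simp
      _ ≤ _ := Finset.sum_le_sum fun k _ => hle k
  interval_cases n
  · simp at hX
  · have := hs 0
    exact Simple.of_iso (e ≪≫ biproductUniqueIso s)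

variable [IsAlgClosed K]

theorem finrank_hom_simple {ι : Type*} [DecidableEq ι] (S : ι → C) [IsCompleteSimples S]
    (i j : ι) :
    Module.finrank K (S i ⟶ S j) = if i = j then 1 else 0 := by
  classical
  rw [finrank_hom_simple_simple]
  refine if_congr ⟨IsCompleteSimples.eq_of_iso i j, ?_⟩ rfl rfl
  rintro rfl
  exact ⟨Iso.refl _⟩

variable {ι : Type*} [Fintype ι] (S : ι → C) [IsCompleteSimples S]

theorem cls_eq_sum_finrank [BraidedCategory C] (X : C) :
    cls K X = ∑ i, (Module.finrank K (S i ⟶ X) : K) • cls K (S i) := by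
  classical
  obtain ⟨n, s, hs, ⟨e⟩⟩ := IsFusionCategory.semisimple (K := K) X
  choose t ht using fun k => IsCompleteSimples.exists_iso (S := S) (s k) (hs k)
  have h1 : cls K X = ∑ k, cls K (S (t k)) := by
    rw [cls_eq_of_iso K e, cls_biproduct]
    exact Finset.sum_congr rfl fun k _ => cls_eq_of_iso K (ht k).some
  have h2 (i : ι) : (Module.finrank K (S i ⟶ X) : K) = ∑ k, if i = t k then 1 else 0 := by
    rw [((homCongrLinear K (Iso.refl (S i)) e).trans (homBiproductEquiv K (S i) s)).finrank_eq,
      Module.finrank_pi_fintype, Nat.cast_sum]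
    refine Finset.sum_congr rfl fun k _ => ?_
    rw [(homCongrLinear K (Iso.refl (S i)) (ht k).some).finrank_eq, finrank_hom_simple]
    split_ifs <;> simp
  simp_rw [h1, h2, Finset.sum_smul]
  rw [Finset.sum_comm]
  simp

theorem fusionAlgebra_eq_sum [BraidedCategory C] (x : FusionAlgebra K C) :
    ∃ c : ι → K, x = ∑ i, c i • cls K (S i) := by
  induction x using fusionAlgebra_induction with
  | zero => exact ⟨0, by simp⟩
  | add x y hx hy =>
    obtain ⟨c, rfl⟩ := hx
    obtain ⟨c', rfl⟩ := hy
    exact ⟨c + c', by simp [add_smul, Finset.sum_add_distrib]⟩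
  | smul c X =>
    refine ⟨fun i => c * (Module.finrank K (S i ⟶ X) : K), ?_⟩
    rw [cls_eq_sum_finrank K S X, Finset.smul_sum]
    simp [mul_smul]

theorem scalar_comp {X : C} [Simple X] (f g : X ⟶ X) :
    scalar K (f ≫ g) = scalar K f * scalar K g :=
  scalar_eq K (by
    conv_rhs => rw [← scalar_smul_id K f, ← scalar_smul_id K g]
    rw [Linear.smul_comp, Category.id_comp, smul_smul])

theorem scalar_smul_one {X : C} [Simple X] (c : K) : scalar K (c • 𝟙 X) = c :=
  scalar_eq K rfl

theorem scalar_sum {X : C} [Simple X] {J : Type*} (s : Finset J) (f : J → (X ⟶ X)) :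
    scalar K (∑ k ∈ s, f k) = ∑ k ∈ s, scalar K (f k) :=
  scalar_eq K (by rw [Finset.sum_smul]; simp [scalar_smul_id])

end Decomposition

theorem sum_smul_mul_sum_smul {R A ι : Type*} [CommRing R] [CommRing A] [Algebra R A] [Fintype ι]
    (f g : ι → R) (x y : ι → A) :
    (∑ i, f i • x i) * (∑ i, g i • y i) = ∑ i, ∑ j, (f i * g j) • (x i * y j) := by
  rw [Finset.sum_mul_sum]
  exact Finset.sum_congr rfl fun i _ => Finset.sum_congr rfl fun j _ => smul_mul_smul_comm ..

/-! ### The tube endomorphism algebra of the unit. -/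

section Tube

variable (K : Type w) [Field K] [IsAlgClosed K]
variable {C : Type u} [Category.{v} C] [Abelian C] [Linear K C] [MonoidalCategory C]
  [IsFusionCategory K C]
variable {ι : Type*} [Fintype ι] (S : ι → C) [IsCompleteSimples S]

variable [BraidedCategory C]

/-- Each pair of dual basis vectors contributes `c • 𝟙 (S i)`, so the coefficient of `S i` is `c`
times its multiplicity in `G`. -/
theorem tubeEndToFusion_tubeOf (G : C) (c : K) :
    tubeEndToFusion K S (tubeOf K S G ((ρ_ G).hom ≫ (c • 𝟙 G) ≫ (λ_ G).inv)) =
      c • cls K G := by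
  have h (i : ι) : (ρ_ (S i)).inv ≫ tubeOf K S G ((ρ_ G).hom ≫ (c • 𝟙 G) ≫ (λ_ G).inv) i ≫
      (λ_ (S i)).hom = ∑ _k : Fin (Module.finrank K (S i ⟶ G)), c • 𝟙 (S i) := by
    rw [tubeOf, Preadditive.sum_comp, Preadditive.comp_sum]
    refine Finset.sum_congr rfl fun k _ => ?_
    have := homBasis_comp_homDualBasis K (S i) G k k
    rw [if_pos rfl] at this
    simp [this]
  change ∑ i, scalar K _ • cls K (S i) = _
  rw [cls_eq_sum_finrank K S G, Finset.smul_sum]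
  refine Finset.sum_congr rfl fun i _ => ?_
  rw [h, scalar_sum, Finset.sum_congr rfl fun k _ => scalar_smul_one K c, smul_smul]
  simp [mul_comm]

theorem tubeEndToFusion_tubeId : tubeEndToFusion K S (tubeId K S (𝟙_ C)) = 1 := by
  have h := tubeEndToFusion_tubeOf K S (𝟙_ C) 1
  rw [one_smul, one_smul, Category.id_comp, cls_unit, ← unitors_equal, unitors_inv_equal] at h
  exact h

variable [MonoidalPreadditive C] [MonoidalLinear K C]

theorem tubeEndToFusion_tubeComp (a b : TubeHom S (𝟙_ C) (𝟙_ C)) :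
    tubeEndToFusion K S (tubeComp K S b a) =
      tubeEndToFusion K S b * tubeEndToFusion K S a := by
  -- Up to unitors each component is an endomorphism of a simple object, so the stacked tube on `S i
  -- ⊗ S j` is again scalar.
  have key (x : TubeHom S (𝟙_ C) (𝟙_ C)) (i : ι) :
      x i = scalar K ((ρ_ (S i)).inv ≫ x i ≫ (λ_ (S i)).hom) • ((ρ_ (S i)).hom ≫ (λ_ (S i)).inv) := by
    have h := scalar_smul_id K ((ρ_ (S i)).inv ≫ x i ≫ (λ_ (S i)).hom)
    rw [Iso.eq_inv_comp, ← Iso.comp_inv_eq] at h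
    generalize scalar K ((ρ_ (S i)).inv ≫ x i ≫ (λ_ (S i)).hom) = c at h ⊢
    rw [← h]
    simp
  have h (i j : ι) : (α_ (S i) (S j) (𝟙_ C)).hom ≫ S i ◁ a j ≫ (α_ (S i) (𝟙_ C) (S j)).inv ≫
      b i ▷ S j ≫ (α_ (𝟙_ C) (S i) (S j)).hom = (ρ_ (S i ⊗ S j)).hom ≫
        ((scalar K ((ρ_ (S i)).inv ≫ b i ≫ (λ_ (S i)).hom) *
          scalar K ((ρ_ (S j)).inv ≫ a j ≫ (λ_ (S j)).hom)) • 𝟙 (S i ⊗ S j)) ≫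
        (λ_ (S i ⊗ S j)).inv := by
    conv_lhs => rw [key a j, key b i]
    simp only [MonoidalLinear.whiskerLeft_smul, MonoidalLinear.smul_whiskerRight,
      Linear.smul_comp, Linear.comp_smul, smul_smul, Category.id_comp]
    congr 1
    monoidal
  rw [tubeComp]
  simp only [map_sum, h, tubeEndToFusion_tubeOf]
  change _ = (∑ i, scalar K _ • cls K (S i)) * (∑ i, scalar K _ • cls K (S i))
  have h2 := sum_smul_mul_sum_smul
    (fun i => scalar K ((ρ_ (S i)).inv ≫ b i ≫ (λ_ (S i)).hom))
    (fun i => scalar K ((ρ_ (S i)).inv ≫ a i ≫ (λ_ (S i)).hom))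
    (fun i => cls K (S i)) (fun i => cls K (S i))
  refine Eq.trans ?_ h2.symm
  exact Finset.sum_congr rfl fun i _ => Finset.sum_congr rfl fun j _ => by rw [cls_tensor]

end Tube

/-! ### Duals of simple objects and Frobenius reciprocity. -/

section Dual

variable {C : Type u} [Category.{v} C] [MonoidalCategory C] [RightRigidCategory C]

/-- Dual objects of isomorphic objects are isomorphic. -/
def dualCongr {X Y : C} (e : X ≅ Y) : dual X ≅ dual Y where
  hom := dualMap e.inv
  inv := dualMap e.hom
  hom_inv_id := by rw [← comp_rightAdjointMate, Iso.hom_inv_id, rightAdjointMate_id]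
  inv_hom_id := by rw [← comp_rightAdjointMate, Iso.inv_hom_id, rightAdjointMate_id]

theorem nonempty_dual_unit_iso : Nonempty (dual (𝟙_ C) ≅ 𝟙_ C) := by
  have : IsIso (η_ (𝟙_ C) (dual (𝟙_ C))) := isIso_coevaluation_unit
  exact ⟨(λ_ _).symm ≪≫ (asIso (η_ (𝟙_ C) (dual (𝟙_ C)))).symm⟩

end Dual

section HomLinear

variable (K : Type w) [Field K]
variable {C : Type u} [Category.{v} C] [Preadditive C] [Linear K C] [MonoidalCategory C]
  [MonoidalPreadditive C] [MonoidalLinear K C]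

/-- The linear version of `tensorRightHomEquiv`. -/
def tensorRightHomLinearEquiv (X Y Y' Z : C) [ExactPairing Y Y'] :
    (X ⊗ Y ⟶ Z) ≃ₗ[K] (X ⟶ Z ⊗ Y') where
  __ := tensorRightHomEquiv X Y Y' Z
  map_add' f g := by simp [tensorRightHomEquiv]
  map_smul' c f := by simp [tensorRightHomEquiv]

variable [RightRigidCategory C] [BraidedCategory C]

/-- Bend `Y` down, braid it past `T`, then bend `T` up. This is the source of `N_star`. -/
theorem finrank_hom_tensor_dual (X Y T : C) :
    Module.finrank K (T ⟶ X ⊗ Y) = Module.finrank K (dual Y ⟶ X ⊗ dual T) := by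
  -- The braiding makes `Y` a dual of `dual Y` on the other side as well.
  let _ : ExactPairing (dual Y) Y := BraidedCategory.exactPairing_swap Y (dual Y)
  exact (((tensorRightHomLinearEquiv K T (dual Y) Y X).symm.trans
    (homCongrLinear K (β_ T (dual Y)) (Iso.refl X))).trans
    (tensorRightHomLinearEquiv K (dual Y) T (dual T) X)).finrank_eq

end HomLinear

/-- Frobenius reciprocity shows that `End(X^∨)` has the dimension of `End(X)`, namely one. -/
theorem simple_dual (K : Type w) [Field K] [IsAlgClosed K]
    {C : Type u} [Category.{v} C] [Abelian C] [Linear K C] [MonoidalCategory C]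
    [MonoidalPreadditive C] [MonoidalLinear K C] [IsFusionCategory K C] [RigidCategory C]
    [BraidedCategory C] (X : C) [Simple X] : Simple (dual X) := by
  refine simple_of_finrank_end_eq_one K ?_
  have h := finrank_hom_tensor_dual K (𝟙_ C) X X
  rw [(homCongrLinear K (Iso.refl X) (λ_ X)).finrank_eq,
    (homCongrLinear K (Iso.refl (dual X)) (λ_ (dual X))).finrank_eq] at h
  rw [← h, finrank_hom_simple_simple_eq_one_iff]
  exact ⟨Iso.refl X⟩

/-! ### Additivity of encircling and the resulting characters of the fusion algebra. -/

section Additive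

variable {C : Type u} [Category.{v} C] [Preadditive C] [MonoidalCategory C]
  [MonoidalPreadditive C] [RightRigidCategory C] [PivotalCategory C]

theorem partialTrace_add {A B X : C} (f g : A ⊗ X ⟶ B ⊗ X) :
    partialTrace X (f + g) = partialTrace X f + partialTrace X g := by
  simp [partialTrace]

variable [BraidedCategory C]

theorem encircle_biprod [HasBinaryBiproducts C] (Y X X' : C) :
    encircle Y (X ⊞ X') = encircle Y X + encircle Y X' := by
  rw [← partialTrace_doubleBraiding_retract Y (biprod.inl : X ⟶ X ⊞ X') biprod.fst (by simp),
    ← partialTrace_doubleBraiding_retract Y (biprod.inr : X' ⟶ X ⊞ X') biprod.snd (by simp),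
    ← partialTrace_add, ← Preadditive.comp_add, ← MonoidalPreadditive.whiskerLeft_add,
    biprod.total, whiskerLeft_id, Category.comp_id, encircle_eq_partialTrace]

end Additive

section Character

variable (K : Type w) [Field K] [IsAlgClosed K]
variable {C : Type u} [Category.{v} C] [Abelian C] [Linear K C] [MonoidalCategory C]
  [IsFusionCategory K C] [RigidCategory C] [PivotalCategory C]

theorem dim_eq_of_iso {X X' : C} (e : X ≅ X') : dim K X = dim K X' := by
  rw [dim, dim, ← e.hom_inv_id, rightTrace_comp_comm, e.inv_hom_id]

theorem dim_dual [IsSpherical C] (X : C) : dim K (dual X) = dim K X := by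
  rw [dim, dim, ← leftTrace_id_eq_rightTrace_id_dual, IsSpherical.leftTrace_eq_rightTrace]

variable [BraidedCategory C]

theorem scalar_encircle_of_iso {Y Y' : C} [Simple Y] [Simple Y'] (e : Y ≅ Y') (X : C) :
    scalar K (encircle Y X) = scalar K (encircle Y' X) :=
  scalar_eq K (by
    rw [← cancel_mono e.hom, ← encircle_naturality, ← scalar_smul_id K (encircle Y' X)]
    rw [scalar_eq K rfl]
    simp)

/-- The multiplicative function on objects given by encircling a simple object. -/
def encircleMonoidHom (Y : C) [Simple Y] : Skeleton C →* K where
  toFun X := scalar K (encircle Y (Quotient.out X : C))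
  map_one' := scalar_eq K (by
    rw [one_smul, ← encircle_unit_right Y]
    exact encircle_eq_of_iso Y (fromSkeletonToSkeletonIso (𝟙_ C)).symm)
  map_mul' X X' := by
    rw [← scalar_comp, ← encircle_tensor]
    exact congrArg (scalar K) (encircle_eq_of_iso Y
      (fromSkeletonToSkeletonIso ((Quotient.out X : C) ⊗ (Quotient.out X' : C))))

theorem encircleMonoidHom_toSkeleton (Y : C) [Simple Y] (X : C) :
    encircleMonoidHom K Y (toSkeleton X) = scalar K (encircle Y X) :=
  congrArg (scalar K) (encircle_eq_of_iso Y (fromSkeletonToSkeletonIso X))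

theorem scalar_encircle_of_iso_unit {Y : C} [Simple Y] (e : Y ≅ 𝟙_ C) (X : C) :
    scalar K (encircle Y X) = dim K X := by
  have := IsFusionCategory.simple_unit (K := K) (C := C)
  rw [scalar_encircle_of_iso K e, encircle_unit_left]
  rfl

variable [MonoidalPreadditive C]

/-- The character of the Grothendieck ring given by encircling a simple object. -/
def grothendieckCharacter (Y : C) [Simple Y] : GrothendieckRing C →ₐ[ℤ] K :=
  Ideal.Quotient.liftₐ (grothendieckRelations C)
    (MonoidAlgebra.lift ℤ K (Skeleton C) (encircleMonoidHom K Y)) (by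
      intro a ha
      refine (Ideal.span_le (I := RingHom.ker
        (MonoidAlgebra.lift ℤ K (Skeleton C) (encircleMonoidHom K Y)))).2 ?_ ha
      rintro _ ⟨X, X', rfl⟩
      rw [SetLike.mem_coe, RingHom.mem_ker]
      simp only [map_sub, map_add, MonoidAlgebra.lift_of, encircleMonoidHom_toSkeleton]
      rw [encircle_biprod, scalar_add, sub_self])

/-- The character of the fusion algebra given by encircling a simple object. -/
def character (Y : C) [Simple Y] : FusionAlgebra K C →ₐ[K] K :=
  Algebra.TensorProduct.lift (AlgHom.id K K) (grothendieckCharacter K Y)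
    fun _ _ => Commute.all _ _

theorem character_cls (Y : C) [Simple Y] (X : C) :
    character K Y (cls K X) = scalar K (encircle Y X) := by
  rw [character, cls, Algebra.TensorProduct.lift_tmul, map_one, one_mul]
  exact (MonoidAlgebra.lift_of _ _).trans (encircleMonoidHom_toSkeleton K Y X)

variable [MonoidalLinear K C]

theorem unitScalar_rightTrace_doubleBraiding (X Y : C) [Simple X] :
    unitScalar K (rightTrace (doubleBraiding X Y)) = dim K X * scalar K (encircle X Y) := by
  have := IsFusionCategory.simple_unit (K := K) (C := C)
  have h : rightTrace (scalar K (encircle X Y) • 𝟙 X) =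
      scalar K (encircle X Y) • rightTrace (𝟙 X) := by
    simp [rightTrace]
  rw [rightTrace_doubleBraiding, ← scalar_smul_id K (encircle X Y), h, mul_comm]
  rw [scalar_eq K rfl]
  exact scalar_smul K _ _

end Character

theorem exists_dual_iso (K : Type w) [Field K] [IsAlgClosed K]
    {C : Type u} [Category.{v} C] [Abelian C] [Linear K C] [MonoidalCategory C]
    [MonoidalPreadditive C] [MonoidalLinear K C] [IsFusionCategory K C] [RigidCategory C]
    [BraidedCategory C] {ι : Type*} (S : ι → C) [IsCompleteSimples S] (i : ι) : ∃ j, Nonempty (dual (S i) ≅ S j) :=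
  IsCompleteSimples.exists_iso _ (simple_dual K (S i))

theorem exists_unit_iso (K : Type w) [Field K]
    {C : Type u} [Category.{v} C] [Abelian C] [Linear K C] [MonoidalCategory C]
    [IsFusionCategory K C] {ι : Type*} (S : ι → C) [IsCompleteSimples S] : ∃ j, Nonempty (𝟙_ C ≅ S j) :=
  IsCompleteSimples.exists_iso _ (IsFusionCategory.simple_unit (K := K))

/-! ### The fusion algebra of a modular category as a `ModularDatum`. -/

section Modular

variable (K : Type w) [Field K] [IsAlgClosed K]
variable {C : Type u} [Category.{v} C] [Abelian C] [Linear K C] [MonoidalCategory C]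
  [MonoidalPreadditive C] [MonoidalLinear K C] [IsFusionCategory K C] [RigidCategory C]
  [PivotalCategory C] [BraidedCategory C]
variable {ι : Type*} (S : ι → C) [IsCompleteSimples S]

/-- The index of the dual of a simple object. -/
def dualIndex (i : ι) : ι := (exists_dual_iso K S i).choose

/-- The dual of a simple object is isomorphic to a simple object of the given set. -/
def dualIndexIso (i : ι) : dual (S i) ≅ S (dualIndex K S i) :=
  (exists_dual_iso K S i).choose_spec.some

/-- The index of the unit object. -/
def unitIndex : ι := (exists_unit_iso K S).choose

/-- The unit object is isomorphic to a simple object of the given set. -/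
def unitIndexIso : 𝟙_ C ≅ S (unitIndex K S) := (exists_unit_iso K S).choose_spec.some

variable [Fintype ι] [DecidableEq ι] [IsSpherical C]

/-- The fusion algebra of a modular tensor category, with its characters. -/
def fusionDatum (h : IsModular K S) : ModularDatum K (FusionAlgebra K C) ι where
  b i := cls K (S i)
  span_b := fusionAlgebra_eq_sum K S
  chi i := character K (S i)
  d i := dim K (S i)
  s := sMatrix K S
  s_apply i j := (unitScalar_rightTrace_doubleBraiding K (S i) (S j)).trans
    (congrArg _ (character_cls K (S i) (S j)).symm)
  s_symm i j := congrArg (unitScalar K) (rightTrace_doubleBraiding_comm (S i) (S j))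
  isUnit_s := h.nondegenerate
  star := dualIndex K S
  star_star i := IsCompleteSimples.eq_of_iso (S := S) _ _ ⟨(dualIndexIso K S _).symm ≪≫
    dualCongr (dualIndexIso K S i).symm ≪≫ (PivotalCategory.pivot (S i)).symm⟩
  d_star i := by rw [← dim_eq_of_iso K (dualIndexIso K S i), dim_dual]
  o := unitIndex K S
  star_o := IsCompleteSimples.eq_of_iso (S := S) _ _ ⟨(dualIndexIso K S _).symm ≪≫
    dualCongr (unitIndexIso K S).symm ≪≫ nonempty_dual_unit_iso.some ≪≫ unitIndexIso K S⟩
  b_o := (cls_eq_of_iso K (unitIndexIso K S).symm).trans (cls_unit K)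
  chi_o j := (character_cls K _ _).trans
    (scalar_encircle_of_iso_unit K (unitIndexIso K S).symm (S j))
  N i j t := Module.finrank K (S t ⟶ S i ⊗ S j)
  b_mul_b i j := (cls_tensor K (S i) (S j)).symm.trans (cls_eq_sum_finrank K S _)
  N_star i j t := congrArg Nat.cast (by
    rw [finrank_hom_tensor_dual K (S i) (S j) (S t)]
    exact (homCongrLinear K (dualIndexIso K S j).symm
      (whiskerLeftIso (S i) (dualIndexIso K S t).symm)).finrank_eq)

end Modular

section Modular

variable (K : Type w) [Field K] [IsAlgClosed K]
variable {C : Type u} [Category.{v} C] [Abelian C] [Linear K C] [MonoidalCategory C]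
  [MonoidalPreadditive C] [MonoidalLinear K C] [IsFusionCategory K C] [RigidCategory C]
  [BraidedCategory C]
variable {ι : Type*} (S : ι → C) [IsCompleteSimples S]

theorem cls_dual (i : ι) : cls K (dual (S i)) = cls K (S (dualIndex K S i)) :=
  cls_eq_of_iso K (dualIndexIso K S i)

variable [PivotalCategory C]

theorem character_cls_smul_id (i j : ι) :
    character K (S (dualIndex K S i)) (cls K (S j)) • 𝟙 (dual (S i)) =
      encircle (dual (S i)) (S j) := by
  have := simple_dual K (S i)
  rw [character_cls, ← scalar_encircle_of_iso K (dualIndexIso K S i), scalar_smul_id]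

variable [Fintype ι] [DecidableEq ι] [IsSpherical C]

/-- The classes of simples span by semisimplicity; their independence comes from the invertible
`S`-matrix. -/
theorem tubeEndToFusion_bijective (h : IsModular K S) :
    Function.Bijective (tubeEndToFusion K S) := by
  refine ⟨?_, fun x => ?_⟩
  · rw [injective_iff_map_eq_zero]
    intro a ha
    have h0 := (fusionDatum K S h).linearIndependent_b
      (c := fun i => scalar K ((ρ_ (S i)).inv ≫ a i ≫ (λ_ (S i)).hom)) ha
    funext i
    have h1 := scalar_smul_id K ((ρ_ (S i)).inv ≫ a i ≫ (λ_ (S i)).hom)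
    have h2 : scalar K ((ρ_ (S i)).inv ≫ a i ≫ (λ_ (S i)).hom) = 0 := congrFun h0 i
    rw [h2, zero_smul] at h1
    rw [Pi.zero_apply, ← cancel_epi (ρ_ (S i)).inv, ← cancel_mono (λ_ (S i)).hom, Category.assoc,
      ← h1, comp_zero, zero_comp]
  · obtain ⟨c, rfl⟩ := fusionAlgebra_eq_sum K S x
    refine ⟨fun i => c i • ((ρ_ (S i)).hom ≫ (λ_ (S i)).inv), ?_⟩
    change ∑ i, scalar K _ • cls K (S i) = _
    refine Finset.sum_congr rfl fun i _ => ?_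
    rw [scalar_eq K (c := c i) (by simp)]

theorem fusionInner_character (h : IsModular K S) (i : ι) :
    fusionInner S (character K (S i)).toLinearMap (character K (S i)).toLinearMap =
      (fusionDatum K S h).pair i i :=
  Finset.sum_congr rfl fun j _ => congrArg (fun x => character K (S i) (cls K (S j)) *
    character K (S i) x) (cls_dual K S j)

theorem spectralIdempotent_character (h : IsModular K S) (i : ι) :
    spectralIdempotent S (character K (S i)) = (fusionDatum K S h).idem i := by
  rw [spectralIdempotent, fusionInner_character K S h]
  exact congrArg _ (Finset.sum_congr rfl fun j _ =>
    congrArg (fun x => character K (S i) x • cls K (S j)) (cls_dual K S j))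

theorem tubeEndToFusion_tubeIdempotent (h : IsModular K S) (i : ι) :
    tubeEndToFusion K S (tubeIdempotent K S i) =
      (fusionDatum K S h).idem (dualIndex K S i) := by
  have h1 (j : ι) : tubeEndToFusion K S (tubeOf K S (S j)
      ((ρ_ (S j)).hom ≫ encircle (S j) (S i) ≫ (λ_ (S j)).inv)) =
        character K (S j) (cls K (S i)) • cls K (S j) := by
    rw [character_cls, ← tubeEndToFusion_tubeOf K S (S j), scalar_smul_id]
  rw [tubeIdempotent]
  simp only [map_smul, map_sum, h1]
  refine Eq.trans ?_ ((fusionDatum K S h).idem_star i).symm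
  rfl

end Modular

end TubeCat

end

open TubeCat

theorem mainTheorem7 {K : Type*} [Field K] [IsAlgClosed K]
    {C : Type*} [Category* C] [Abelian C] [Linear K C] [MonoidalCategory C]
    [MonoidalPreadditive C] [MonoidalLinear K C] [IsFusionCategory K C]
    [RigidCategory C] [PivotalCategory C] [IsSpherical C] [BraidedCategory C]
    {ι : Type*} [Fintype ι] [DecidableEq ι] (S : ι → C) [IsCompleteSimples S]
    (hmod : IsModular K S) :
    -- the canonical map `End_TC(𝟙) → F` is an isomorphism of algebras
    (Function.Bijective (tubeEndToFusion K S) ∧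
      tubeEndToFusion K S (tubeId K S (𝟙_ C)) = 1 ∧
      ∀ a b : TubeHom S (𝟙_ C) (𝟙_ C),
        tubeEndToFusion K S (tubeComp K S b a) =
          tubeEndToFusion K S b * tubeEndToFusion K S a) ∧
    -- the spectrum of `F` consists of the characters `lam I`
    ∃ lam : ι → (FusionAlgebra K C →ₐ[K] K),
      (∀ I j, lam I (cls K (S j)) • 𝟙 (dual (S I)) = encircle (dual (S I)) (S j)) ∧
      Function.Bijective lam ∧
      ∀ I,
        -- `e_{lam I}` is the idempotent corresponding to `lam I`, and it equals `𝟏_I`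
        (∀ e, IsSpectralIdempotent (lam I) e ↔ e = spectralIdempotent S (lam I)) ∧
        spectralIdempotent S (lam I) = tubeEndToFusion K S (tubeIdempotent K S I) ∧
        IsPrimitiveIdempotent (spectralIdempotent S (lam I)) ∧
        dim K (S I) ≠ 0 ∧ globalDim K S ≠ 0 ∧
        fusionInner S (lam I).toLinearMap (lam I).toLinearMap =
          globalDim K S / dim K (S I) ^ 2 := by
  let M := fusionDatum K S hmod
  refine ⟨⟨tubeEndToFusion_bijective K S hmod, tubeEndToFusion_tubeId K S,
    tubeEndToFusion_tubeComp K S⟩,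
    -- The strand encircled in `λ_I` is the dual of `S I`, whence the dual index.
    fun I => character K (S (dualIndex K S I)), character_cls_smul_id K S, ?_, fun I => ?_⟩
  · exact (show Function.Bijective M.chi from ⟨M.chi_injective, M.chi_surjective⟩).comp
      M.starEquiv.bijective
  · refine ⟨fun e => ?_, ?_, ?_, M.d_ne_zero I, M.sum_d_sq_ne_zero, ?_⟩
    · rw [spectralIdempotent_character K S hmod]
      exact M.spectral_iff_eq_idem (M.star I) e
    · rw [spectralIdempotent_character K S hmod, tubeEndToFusion_tubeIdempotent K S hmod]
    · rw [spectralIdempotent_character K S hmod]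
      exact M.isPrimitiveIdempotent_idem (M.star I)
    · rw [fusionInner_character K S hmod]
      exact (M.pair_self (M.star I)).trans (by rw [M.d_star]; rfl)
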